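/- Let $F$ be a field. A (finite) filtered chain complex $\mathcal K$ over $F$ consists of a finite set of cells, each cell $a$ having a dimension $\dim a\in\mathbb N$ and a filtration value $g(a)\in\mathbb Z$, and of incidence indices $\kappa(A,b)\in F$ such that $\kappa(A,b)\neq 0$ implies $\dim A=\dim b+1$ and $g(b)\le g(A)$, and such that the boundary operator $\partial A=\sum_b\kappa(A,b)\,b$ satisfies $\partial\partial=0$. For $t\in\mathbb Z$ let $\mathcal K_t$ be the subcomplex of the cells with $g\le t$, let $\mathcal K_\infty=\mathcal K$, and let $\beta_d^{s,t}(\mathcal K)$ be the rank of $H_d(\mathcal K_s)\to H_d(\mathcal K_t)$, $s\le t$. The persistence intervals of $\mathcal K$ are the multiset in which, in dimension $d$, the finite interval $[i,j)$, $i<j$, has multiplicity $(\beta_d^{i,j-1}-\beta_d^{i,j})-(\beta_d^{i-1,j-1}-\beta_d^{i-1,j})$ and the infinite interval $[i,\infty)$ has multiplicity $\beta_d^{i,\infty}-\beta_d^{i-1,\infty}$; this is a well-defined finite multiset. A matching on $\mathcal K$ is a set of pairs $(b,A)$ of cells with $\kappa(A,b)\ne0$ such that every cell lies in at most one pair. Its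 Morse graph has an edge $A\to b$ whenever $\kappa(A,b)\neq0$ and $(b,A)$ is not matched, of weight $\kappa(A,b)$, and an edge $b\to A$ for each matched pair $(b,A)$, of weight $-\kappa(A,b)^{-1}$. The matching is acyclic if this directed graph has no directed cycle, and compatible with the filtration if $g(b)=g(A)$ for all matched pairs. The Morse complex of an acyclic compatible matching has the unmatched cells as cells, with their dimensions and filtration values; the incidence index of $A$ and $b$ with $\dim A=\dim b+1$ is the sum, over all directed paths from $A$ to $b$ in the Morse graph, of the product of the weights of the edges (for $F=\mathbb Z_2$: the number of paths modulo $2$). Let $\mathbb M$ assign to each filtered chain complex the Morse complex of some acyclic matching compatible with the filtration, and let $\mathbb M$ be vital: whenever a complex admits a nonempty acyclic compatible matching, the matching used by $\mathbb M$ is nonempty. The sequence $\mathcal K,\mathbb M(\mathcal K),\mathbb M^2(\mathcal K),\dots$ reaches a fixed point of $\mathbb M$ after finitely many steps; this fixed point is the iterated Morse complex $\mathbb M^\infty(\mathcal K)$. Theorem. Let $\mathcal K$ be a filtered chain complex with $p$ finite and $k$ infinite persistence intervals (over all dimensions). Then $\mathbb M^\infty(\mathcal K)$ has exactly $2p+k$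 cells. Moreover it is a smallest complex that encodes the persistence of $\mathcal K$: $\mathbb M^\infty(\mathcal K)$ has the same persistence intervals as $\mathcal K$, and every filtered chain complex over $F$ with the same persistence intervals as $\mathcal K$ has at least as many cells as $\mathbb M^\infty(\mathcal K)$. -/

import Mathlib

open scoped Matrix

/-- A finite filtered chain complex over a field `F` with a distinguished basis of cells.
The cells form a finite set inside an ambient finite type `ι`; `inc A b` is the incidence index
(the coefficient of `b` in the boundary of `A`), so boundaries are the rows of `inc`, and `lvl` is
the filtering function. -/
@[ext]
structure FilteredComplex (F : Type*) [Field F] (ι : Type*) [Fintype ι] where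
  cells : Finset ι
  dim : ι → ℕ
  lvl : ι → ℤ
  inc : Matrix ι ι F
  mem_of_inc : ∀ A b, inc A b ≠ 0 → A ∈ cells ∧ b ∈ cells
  dim_of_inc : ∀ A b, inc A b ≠ 0 → dim A = dim b + 1
  lvl_of_inc : ∀ A b, inc A b ≠ 0 → lvl b ≤ lvl A
  inc_mul_inc : inc * inc = 0

namespace FilteredComplex

section Homology

variable {F : Type*} [Field F] {ι : Type*} [Fintype ι] (K : FilteredComplex F ι)

/-- The boundary operator: `∂ (∑ a_A A) = ∑ a_A ∑ inc A b • b`. -/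
def boundary : (ι → F) →ₗ[F] (ι → F) := K.inc.vecMulLinear

/-- The `d`-chains of the sublevel complex `K_t = {x | lvl x ≤ t}`; `K_⊤` is the whole `K`. -/
def chains (d : ℕ) (t : WithTop ℤ) : Submodule F (ι → F) where
  carrier := {c | ∀ x, c x ≠ 0 → x ∈ K.cells ∧ K.dim x = d ∧ (K.lvl x : WithTop ℤ) ≤ t}
  zero_mem' := fun x hx => absurd rfl hx
  add_mem' := by
    intro a b ha hb x hx
    by_cases h : a x = 0
    · exact hb x (by simpa [h] using hx)
    · exact ha x h
  smul_mem' := by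
    intro r a ha x hx
    exact ha x (fun h => hx (by simp [h]))

/-- `d`-cycles of `K_t`. -/
def cycles (d : ℕ) (t : WithTop ℤ) : Submodule F (ι → F) :=
  K.chains d t ⊓ LinearMap.ker K.boundary

/-- `d`-boundaries of `K_t`. -/
def boundaries (d : ℕ) (t : WithTop ℤ) : Submodule F (ι → F) :=
  (K.chains (d + 1) t).map K.boundary

theorem chains_mono (d : ℕ) {s t : WithTop ℤ} (h : s ≤ t) : K.chains d s ≤ K.chains d t :=
  fun _ hc x hx => ⟨(hc x hx).1, (hc x hx).2.1, (hc x hx).2.2.trans h⟩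

theorem cycles_mono (d : ℕ) {s t : WithTop ℤ} (h : s ≤ t) : K.cycles d s ≤ K.cycles d t :=
  inf_le_inf_right _ (K.chains_mono d h)

theorem boundaries_mono (d : ℕ) {s t : WithTop ℤ} (h : s ≤ t) :
    K.boundaries d s ≤ K.boundaries d t :=
  Submodule.map_mono (K.chains_mono (d + 1) h)

/-- The homology `H_d(K_t)`. -/
abbrev Homology (d : ℕ) (t : WithTop ℤ) : Type _ :=
  K.cycles d t ⧸ (K.boundaries d t).submoduleOf (K.cycles d t)

/-- The map `H_d(K_s) → H_d(K_t)` induced by the inclusion. -/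
def homologyMap (d : ℕ) {s t : WithTop ℤ} (h : s ≤ t) : K.Homology d s →ₗ[F] K.Homology d t :=
  Submodule.mapQ _ _ (Submodule.inclusion (K.cycles_mono d h))
    (fun _ hx => K.boundaries_mono d h hx)

open scoped Classical in
/-- The persistent Betti number: the rank of `H_d(K_s) → H_d(K_t)`. -/
noncomputable def persistentBetti (d : ℕ) (s t : WithTop ℤ) : ℕ :=
  if h : s ≤ t then Module.finrank F (LinearMap.range (K.homologyMap d h)) else 0

/-- The number of `d`-dimensional classes that are born at `i` and die at `j`
(`j = ⊤` for the classes that never die); only intervals of positive length count. -/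
noncomputable def multiplicity (d : ℕ) (i : ℤ) : WithTop ℤ → ℤ
  | ⊤ => (K.persistentBetti d i ⊤ : ℤ) - K.persistentBetti d ((i - 1 : ℤ) : WithTop ℤ) ⊤
  | (j : ℤ) =>
    if i < j then
      ((K.persistentBetti d i ((j - 1 : ℤ) : WithTop ℤ) : ℤ) - K.persistentBetti d i j)
        - ((K.persistentBetti d ((i - 1 : ℤ) : WithTop ℤ) ((j - 1 : ℤ) : WithTop ℤ) : ℤ)
          - K.persistentBetti d ((i - 1 : ℤ) : WithTop ℤ) j)
    else 0

open scoped Classical in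
/-- `B` is the multiset of persistence intervals of `K`: the triple `(d, i, j)` stands for a
`d`-dimensional interval `[i, j)`. The condition determines `B`. -/
def IsBarcode (B : Multiset (ℕ × ℤ × WithTop ℤ)) : Prop :=
  ∀ (d : ℕ) (i : ℤ) (j : WithTop ℤ), (B.count (d, i, j) : ℤ) = K.multiplicity d i j

end Homology

end FilteredComplex

open scoped Classical in
/-- The number of finite intervals. -/
noncomputable def numFinite (B : Multiset (ℕ × ℤ × WithTop ℤ)) : ℕ :=
  B.countP (fun I => I.2.2 ≠ ⊤)

open scoped Classical in
/-- The number of infinite intervals. -/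
noncomputable def numInfinite (B : Multiset (ℕ × ℤ × WithTop ℤ)) : ℕ :=
  B.countP (fun I => I.2.2 = ⊤)

/-- An edge `x → y` of the Morse graph of an incidence matrix and a set of matched pairs
(`pair b A`: the face `b` is matched with `A`): from a cell to a face it is not matched with, or
from a face to the cell it is matched with. -/
def MorseEdge {F : Type*} [Field F] {ι : Type*} (inc : Matrix ι ι F) (pair : ι → ι → Prop)
    (x y : ι) : Prop :=
  (inc x y ≠ 0 ∧ ¬ pair y x) ∨ pair x y

/-- An acyclic Morse matching on `K`, compatible with the filtration. -/
structure FilteredMatching {F : Type*} [Field F] {ι : Type*} [Fintype ι]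
    (K : FilteredComplex F ι) where
  /-- `pair b A`: the face `b` is matched with its coface `A`. -/
  pair : ι → ι → Prop
  inc_ne_zero : ∀ b A, pair b A → K.inc A b ≠ 0
  up_unique : ∀ b A A', pair b A → pair b A' → A = A'
  down_unique : ∀ b b' A, pair b A → pair b' A → b = b'
  not_both : ∀ a b c, pair a b → ¬ pair b c
  acyclic : ∀ x, ¬ Relation.TransGen (MorseEdge K.inc pair) x x
  compatible : ∀ b A, pair b A → K.lvl b = K.lvl A

namespace FilteredMatching

/-- At least one pair is matched. -/
def Nontrivial {F : Type*} [Field F] {ι : Type*} [Fintype ι] {K : FilteredComplex F ι}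
    (m : FilteredMatching K) : Prop := ∃ b A, m.pair b A

/-- `x` is matched with some cell. -/
def Matched {F : Type*} [Field F] {ι : Type*} [Fintype ι] {K : FilteredComplex F ι}
    (m : FilteredMatching K) (x : ι) : Prop := (∃ A, m.pair x A) ∨ (∃ b, m.pair b x)

section Morse

variable {F : Type*} [Field F] {ι : Type*} [Fintype ι]
  {K : FilteredComplex F ι} (m : FilteredMatching K)

open scoped Classical in
/-- Weights of the downward edges of the Morse graph. -/
noncomputable def down : Matrix ι ι F :=
  Matrix.of fun A b => if m.pair b A then 0 else K.inc A b

open scoped Classical in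
/-- Weights of the upward (reversed) edges of the Morse graph. -/
noncomputable def up : Matrix ι ι F :=
  Matrix.of fun b A => if m.pair b A then -(K.inc A b)⁻¹ else 0

open scoped Classical in
/-- The critical cells. -/
noncomputable def critical : Finset ι := K.cells.filter fun x => ¬ m.Matched x

/-- The sum of the weights of all V-paths `A → b₁ ⇒ A₁ → b₂ ⇒ A₂ → ⋯ ⇒ Aₖ → b`, `k ≥ 0`, where
`→` are downward edges of the Morse graph and `⇒` reversed ones; the weight of a path is the
product of the weights of its edges. By acyclicity a path has fewer than `card ι` reversed edges.
Over `ZMod 2` all weights are `1` and this is the number of paths modulo 2. -/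
noncomputable def pathSum [DecidableEq ι] : Matrix ι ι F :=
  ∑ k ∈ Finset.range (Fintype.card ι + 1), m.down * (m.up * m.down) ^ k

/-- The Morse boundary: path sums between critical cells. -/
noncomputable def morseInc [DecidableEq ι] : Matrix ι ι F :=
  Matrix.of fun A b => if A ∈ m.critical ∧ b ∈ m.critical then m.pathSum A b else 0

end Morse

end FilteredMatching

section Facts

theorem Matrix.pow_eq_zero_of_rank {F : Type*} [Field F] {ι : Type*} [Fintype ι] [DecidableEq ι]
    (M : Matrix ι ι F) (r : ι → ℕ) (hr : ∀ x y, M x y ≠ 0 → r y < r x) (n : ℕ)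
    (hn : ∀ x, r x < n) : M ^ n = 0 := by
  have key : ∀ k x y, (M ^ k) x y ≠ 0 → r y + k ≤ r x := by
    intro k
    induction k with
    | zero =>
      intro x y h
      by_cases hxy : x = y
      · simp [hxy]
      · simp [hxy] at h
    | succ k ih =>
      intro x y h
      rw [pow_succ, Matrix.mul_apply] at h
      obtain ⟨z, -, hz⟩ := Finset.exists_ne_zero_of_sum_ne_zero h
      have h1 := ih x z (left_ne_zero_of_mul hz)
      have h2 := hr z y (right_ne_zero_of_mul hz)
      omega
  ext x y
  by_contra h
  have h1 := key n x y h
  have h2 := hn x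
  omega

/-- A noncommutative Schur complement squares to zero. -/
theorem schur_sq_zero {R : Type*} [Ring R] (D P Q D' C L U : R) (n : ℕ)
    (hD : D * D = 0) (hD' : D = D' + P) (hsum : C + L + U = 1)
    (hLQ : L * Q = Q) (hQU : Q * U = Q) (hPL : P * L = P) (hUP : U * P = P)
    (hQP : Q * P = -L) (hPQ : P * Q = -U) (hCP : C * P = 0) (hPC : P * C = 0)
    (hCC : C * C = C) (hnil : (Q * D') ^ n = 0) (S : R)
    (hSdef : S = ∑ k ∈ Finset.range (n + 1), D' * (Q * D') ^ k) :
    (C * S * C) * (C * S * C) = 0 := by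
  obtain ⟨g, hg⟩ : ∃ g, g = ∑ k ∈ Finset.range n, (Q * D') ^ k := ⟨_, rfl⟩
  have hg1 : g * (Q * D') = g - 1 := by
    have h := geom_sum_mul (Q * D') n
    rw [← hg, hnil, mul_sub, mul_one] at h
    rw [sub_eq_iff_eq_add] at h
    rw [h]; abel
  have hg2 : (Q * D') * g = g - 1 := by
    have h := mul_geom_sum (Q * D') n
    rw [← hg, hnil, sub_mul, one_mul] at h
    rw [sub_eq_iff_eq_add] at h
    rw [h]; abel
  have hS : S = D' + D' * (g * Q) * D' := by
    have : S = D' * g := by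
      simp only [hSdef, Finset.sum_range_succ, hnil, mul_zero, add_zero, hg, Finset.mul_sum]
    rw [this]
    have : D' * (g * Q) * D' = D' * (g * (Q * D')) := by noncomm_ring
    rw [this, hg1]; noncomm_ring
  obtain ⟨h, hh⟩ : ∃ h, h = g * Q := ⟨_, rfl⟩
  obtain ⟨X, hX⟩ : ∃ X, X = D + D * h * D := ⟨_, rfl⟩
  have hgQ : g * Q = Q + Q * D' * g * Q := by
    rw [hg2]; noncomm_ring
  have hLh : L * h = h := by
    rw [hh, hgQ, mul_add, hLQ]
    congr 1
    calc L * (Q * D' * g * Q) = (L * Q) * D' * g * Q := by noncomm_ring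
      _ = _ := by rw [hLQ]
  have hhU : h * U = h := by rw [hh, mul_assoc, hQU]
  have e1 : h * D * L = -L := by
    have : h * D * L = (g * (Q * D')) * L + g * (Q * (P * L)) := by
      rw [hh, hD']; noncomm_ring
    rw [this, hg1, hPL, hQP]; noncomm_ring
  have e2 : U * D * h = -U := by
    have : U * D * h = U * (D' * g * Q) + (U * P) * g * Q := by
      rw [hh, hD']; noncomm_ring
    rw [this, hUP]
    have hp : P * g * Q = P * Q + P * Q * D' * g * Q := by
      calc P * g * Q = P * (g * Q) := by noncomm_ring
        _ = P * (Q + Q * D' * g * Q) := by rw [← hgQ]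
        _ = _ := by noncomm_ring
    rw [hp, hPQ]; noncomm_ring
  have hXL : X * L = 0 := by
    have : X * L = D * L + D * (h * D * L) := by rw [hX]; noncomm_ring
    rw [this, e1]; noncomm_ring
  have hUX : U * X = 0 := by
    have : U * X = U * D + (U * D * h) * D := by rw [hX]; noncomm_ring
    rw [this, e2]; noncomm_ring
  have hXX : X * X = 0 := by
    have : X * X = (D * D) + (D * D) * h * D + D * h * (D * D)
        + D * h * (D * D) * h * D := by rw [hX]; noncomm_ring
    rw [this, hD]; simp
  have hXCX : X * C * X = 0 := by
    have hC : C = 1 - L - U := by rw [← hsum]; abel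
    have : X * C * X = X * X - X * L * X - X * (U * X) := by rw [hC]; noncomm_ring
    rw [this, hXX, hXL, hUX]; simp
  have hCD : C * D' = C * D := by rw [hD', mul_add, hCP, add_zero]
  have hDC : D' * C = D * C := by rw [hD', add_mul, hPC, add_zero]
  have hCSC : C * S * C = C * X * C := by
    rw [hS, hX, ← hh]
    calc C * (D' + D' * h * D') * C = C * D' * C + (C * D') * h * (D' * C) := by noncomm_ring
      _ = C * D * C + (C * D) * h * (D * C) := by rw [hCD, hDC]
      _ = _ := by noncomm_ring
  rw [hCSC]
  calc C * X * C * (C * X * C) = C * (X * (C * C) * X) * C := by noncomm_ring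
    _ = 0 := by rw [hCC, hXCX]; simp

end Facts

namespace FilteredMatching

section MorseFacts

variable {F : Type*} [Field F] {ι : Type*} [Fintype ι]
  {K : FilteredComplex F ι} (m : FilteredMatching K)

theorem down_ne_zero {A b : ι} (h : m.down A b ≠ 0) : K.inc A b ≠ 0 ∧ ¬ m.pair b A := by
  unfold down at h
  simp only [Matrix.of_apply] at h
  split_ifs at h with hp
  · exact absurd rfl h
  · exact ⟨h, hp⟩

theorem up_ne_zero {b A : ι} (h : m.up b A ≠ 0) : m.pair b A := by
  unfold up at h
  simp only [Matrix.of_apply] at h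
  split_ifs at h with hp
  · exact hp
  · exact absurd rfl h

theorem up_mul_down_ne_zero {x y : ι} (h : (m.up * m.down) x y ≠ 0) :
    ∃ A, m.pair x A ∧ K.inc A y ≠ 0 ∧ ¬ m.pair y A := by
  rw [Matrix.mul_apply] at h
  obtain ⟨A, -, hA⟩ := Finset.exists_ne_zero_of_sum_ne_zero h
  exact ⟨A, m.up_ne_zero (left_ne_zero_of_mul hA), m.down_ne_zero (right_ne_zero_of_mul hA)⟩

theorem pow_up_mul_down_eq_zero [DecidableEq ι] : (m.up * m.down) ^ Fintype.card ι = 0 := by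
  classical
  refine Matrix.pow_eq_zero_of_rank _
    (fun x => (Finset.univ.filter fun y => Relation.TransGen (MorseEdge K.inc m.pair) x y).card)
    ?_ _ ?_
  · intro x y h
    obtain ⟨A, h1, h2, h3⟩ := m.up_mul_down_ne_zero h
    have e1 : MorseEdge K.inc m.pair x A := Or.inr h1
    have e2 : MorseEdge K.inc m.pair A y := Or.inl ⟨h2, h3⟩
    have hxy : Relation.TransGen (MorseEdge K.inc m.pair) x y :=
      (Relation.TransGen.single e1).tail e2
    refine Finset.card_lt_card (Finset.ssubset_iff_of_subset ?_ |>.2 ⟨y, ?_, ?_⟩)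
    · intro z hz
      simp only [Finset.mem_filter, Finset.mem_univ, true_and] at hz ⊢
      exact hxy.trans hz
    · simpa using hxy
    · simpa using m.acyclic y
  · intro x
    exact Finset.card_lt_univ_of_notMem (x := x) (by simpa using m.acyclic x)

theorem pow_up_mul_down_ne_zero [DecidableEq ι] (k : ℕ) {x y : ι} (h : ((m.up * m.down) ^ k) x y ≠ 0) :
    K.dim x = K.dim y ∧ K.lvl y ≤ K.lvl x := by
  induction k generalizing y with
  | zero =>
    by_cases hxy : x = y
    · simp [hxy]
    · simp [hxy] at h
  | succ k ih =>
    rw [pow_succ, Matrix.mul_apply] at h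
    obtain ⟨z, -, hz⟩ := Finset.exists_ne_zero_of_sum_ne_zero h
    obtain ⟨h1, h2⟩ := ih (left_ne_zero_of_mul hz)
    obtain ⟨A, hA, hy, -⟩ := m.up_mul_down_ne_zero (right_ne_zero_of_mul hz)
    have d1 := K.dim_of_inc _ _ (m.inc_ne_zero _ _ hA)
    have d2 := K.dim_of_inc _ _ hy
    have l1 := m.compatible _ _ hA
    have l2 := K.lvl_of_inc _ _ hy
    constructor <;> omega

theorem pathSum_ne_zero [DecidableEq ι] {A b : ι} (h : m.pathSum A b ≠ 0) :
    K.dim A = K.dim b + 1 ∧ K.lvl b ≤ K.lvl A := by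
  unfold pathSum at h
  rw [Matrix.sum_apply] at h
  obtain ⟨k, -, hk⟩ := Finset.exists_ne_zero_of_sum_ne_zero h
  rw [Matrix.mul_apply] at hk
  obtain ⟨z, -, hz⟩ := Finset.exists_ne_zero_of_sum_ne_zero hk
  obtain ⟨h1, h2⟩ := m.pow_up_mul_down_ne_zero k (right_ne_zero_of_mul hz)
  have h3 := (m.down_ne_zero (left_ne_zero_of_mul hz)).1
  have d := K.dim_of_inc _ _ h3
  have l := K.lvl_of_inc _ _ h3
  constructor <;> omega

theorem morseInc_ne_zero [DecidableEq ι] {A b : ι} (h : m.morseInc A b ≠ 0) :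
    (A ∈ m.critical ∧ b ∈ m.critical) ∧ m.pathSum A b ≠ 0 := by
  unfold morseInc at h
  simp only [Matrix.of_apply] at h
  split_ifs at h with hp
  · exact ⟨hp, h⟩
  · exact absurd rfl h

theorem morseInc_mul_morseInc [DecidableEq ι] : m.morseInc * m.morseInc = 0 := by
  classical
  let P : Matrix ι ι F := Matrix.of fun A b => if m.pair b A then K.inc A b else 0
  let L : Matrix ι ι F := Matrix.diagonal fun x => if ∃ A, m.pair x A then 1 else 0
  let U : Matrix ι ι F := Matrix.diagonal fun x => if ∃ b, m.pair b x then 1 else 0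
  let C : Matrix ι ι F := Matrix.diagonal fun x => if m.Matched x then 0 else 1
  have hD' : K.inc = m.down + P := by
    ext A b
    by_cases h : m.pair b A <;> simp [P, down, h]
  have hsum : C + L + U = 1 := by
    rw [← Matrix.diagonal_one, Matrix.diagonal_add, Matrix.diagonal_add]
    congr 1
    ext x
    by_cases h1 : ∃ A, m.pair x A <;> by_cases h2 : ∃ b, m.pair b x
    · obtain ⟨A, hA⟩ := h1
      obtain ⟨b, hb⟩ := h2
      exact absurd hA (m.not_both _ _ _ hb)
    all_goals simp [Matched, h1, h2]
  have hLQ : L * m.up = m.up := by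
    ext x y
    by_cases h : m.pair x y
    · have : ∃ A, m.pair x A := ⟨y, h⟩
      simp [L, Matrix.diagonal_mul, this]
    · simp [L, Matrix.diagonal_mul, up, h]
  have hQU : m.up * U = m.up := by
    ext x y
    by_cases h : m.pair x y
    · have : ∃ b, m.pair b y := ⟨x, h⟩
      simp [U, Matrix.mul_diagonal, this]
    · simp [U, Matrix.mul_diagonal, up, h]
  have hPL : P * L = P := by
    ext x y
    by_cases h : m.pair y x
    · have : ∃ A, m.pair y A := ⟨x, h⟩
      simp [L, Matrix.mul_diagonal, this]
    · simp [L, P, Matrix.mul_diagonal, h]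
  have hUP : U * P = P := by
    ext x y
    by_cases h : m.pair y x
    · have : ∃ b, m.pair b x := ⟨y, h⟩
      simp [U, Matrix.diagonal_mul, this]
    · simp [U, P, Matrix.diagonal_mul, h]
  have hCP : C * P = 0 := by
    ext x y
    by_cases h : m.pair y x
    · have : m.Matched x := Or.inr ⟨y, h⟩
      simp [C, Matrix.diagonal_mul, this]
    · simp [C, P, Matrix.diagonal_mul, h]
  have hPC : P * C = 0 := by
    ext x y
    by_cases h : m.pair y x
    · have : m.Matched y := Or.inl ⟨x, h⟩
      simp [C, Matrix.mul_diagonal, this]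
    · simp [C, P, Matrix.mul_diagonal, h]
  have hQP : m.up * P = -L := by
    ext x y
    rw [Matrix.mul_apply]
    by_cases h : ∃ A, m.pair x A
    · obtain ⟨A, hA⟩ := h
      rw [Finset.sum_eq_single A]
      · by_cases hxy : x = y
        · subst hxy
          have h0 := m.inc_ne_zero _ _ hA
          have h1 : ∃ A, m.pair x A := ⟨A, hA⟩
          simp [up, P, L, hA, h0, h1]
        · have : ¬ m.pair y A := fun h => hxy (m.down_unique _ _ _ hA h)
          simp [P, L, this, hxy]
      · intro B _ hB
        have : ¬ m.pair x B := fun h => hB (m.up_unique _ _ _ h hA)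
        simp [up, this]
      · simp
    · have h' : ∀ A, ¬ m.pair x A := fun A hA => h ⟨A, hA⟩
      simp [up, L, h', Matrix.diagonal_apply]
  have hPQ : P * m.up = -U := by
    ext x y
    rw [Matrix.mul_apply]
    by_cases h : ∃ b, m.pair b x
    · obtain ⟨b, hb⟩ := h
      rw [Finset.sum_eq_single b]
      · by_cases hxy : x = y
        · subst hxy
          have h0 := m.inc_ne_zero _ _ hb
          have h1 : ∃ b, m.pair b x := ⟨b, hb⟩
          simp [up, P, U, hb, h0, h1]
        · have : ¬ m.pair b y := fun h => hxy (m.up_unique _ _ _ hb h)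
          simp [up, U, this, hxy]
      · intro c _ hc
        have : ¬ m.pair c x := fun h => hc (m.down_unique _ _ _ h hb)
        simp [P, this]
      · simp
    · have h' : ∀ b, ¬ m.pair b x := fun b hb => h ⟨b, hb⟩
      simp [P, U, h', Matrix.diagonal_apply]
  have hCC : C * C = C := by
    simp [C, Matrix.diagonal_mul_diagonal]
  have hS := schur_sq_zero K.inc P m.up m.down C L U (Fintype.card ι) K.inc_mul_inc hD' hsum hLQ
    hQU hPL hUP hQP hPQ hCP hPC hCC m.pow_up_mul_down_eq_zero m.pathSum rfl
  have hM : m.morseInc = C * m.pathSum * C := by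
    -- cells outside `K.cells` have no incidences, so projecting to unmatched ones suffices
    have hout : ∀ A b, m.pathSum A b ≠ 0 → A ∈ K.cells ∧ b ∈ K.cells := by
      intro A b h
      unfold pathSum at h
      rw [Matrix.sum_apply] at h
      obtain ⟨k, -, hk⟩ := Finset.exists_ne_zero_of_sum_ne_zero h
      constructor
      · rw [Matrix.mul_apply] at hk
        obtain ⟨z, -, hz⟩ := Finset.exists_ne_zero_of_sum_ne_zero hk
        exact (K.mem_of_inc _ _ (m.down_ne_zero (left_ne_zero_of_mul hz)).1).1
      · rw [show m.down * (m.up * m.down) ^ k = (m.down * m.up) ^ k * m.down from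
          (mul_pow_mul _ _ _).symm, Matrix.mul_apply] at hk
        obtain ⟨z, -, hz⟩ := Finset.exists_ne_zero_of_sum_ne_zero hk
        exact (K.mem_of_inc _ _ (m.down_ne_zero (right_ne_zero_of_mul hz)).1).2
    ext A b
    by_cases h0 : m.pathSum A b = 0
    · simp [morseInc, C, Matrix.diagonal_mul, Matrix.mul_diagonal, h0]
    · obtain ⟨hA, hb⟩ := hout A b h0
      by_cases h1 : m.Matched A <;> by_cases h2 : m.Matched b <;>
        simp [morseInc, critical, C, Matrix.diagonal_mul, Matrix.mul_diagonal, hA, hb, h1, h2]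
  rw [hM]
  exact hS

end MorseFacts

end FilteredMatching

namespace FilteredComplex

section Iteration

variable {F : Type*} [Field F] {ι : Type*} [Fintype ι] [DecidableEq ι]

/-- The Morse complex of a matching: the critical cells with their inherited dimensions and
filtration values and the Morse boundary. -/
noncomputable def morseComplex (K : FilteredComplex F ι) (m : FilteredMatching K) :
    FilteredComplex F ι where
  cells := m.critical
  dim := K.dim
  lvl := K.lvl
  inc := m.morseInc
  mem_of_inc := fun _ _ h => (m.morseInc_ne_zero h).1
  dim_of_inc := fun _ _ h => (m.pathSum_ne_zero (m.morseInc_ne_zero h).2).1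
  lvl_of_inc := fun _ _ h => (m.pathSum_ne_zero (m.morseInc_ne_zero h).2).2
  inc_mul_inc := m.morseInc_mul_morseInc

/-- The Morse construction `𝕄` of a strategy `σ` that chooses a matching on every complex. -/
noncomputable def morseStep (σ : (K : FilteredComplex F ι) → FilteredMatching K)
    (K : FilteredComplex F ι) : FilteredComplex F ι :=
  K.morseComplex (σ K)

/-- The iterated Morse complex `𝕄^∞(K)`: the first complex of the sequence
`K, 𝕄(K), 𝕄(𝕄(K)), …` that is a fixed point of `𝕄`. -/
noncomputable def iteratedMorse (σ : (K : FilteredComplex F ι) → FilteredMatching K)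
    (K : FilteredComplex F ι) : FilteredComplex F ι :=
  (morseStep σ)^[sInf {n : ℕ | Function.IsFixedPt (morseStep σ) ((morseStep σ)^[n] K)}] K

/-- Vitality: if some compatible matching of `K` matches anything, so does the chosen one. -/
def Vital (σ : (K : FilteredComplex F ι) → FilteredMatching K) : Prop :=
  ∀ K, (∃ m : FilteredMatching K, m.Nontrivial) → (σ K).Nontrivial

end Iteration

end FilteredComplex

/-! Two facts give the theorem. First, a compatible Morse reduction changes no persistent Betti
number: eliminating the matched block of the boundary matrix by a Schur complement gives a
deformation retraction whose maps and homotopy do not raise the level (`schur_retract`,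
`persistentBetti_morseComplex`). Second, a fixed point of a vital strategy has no incidence between
cells of equal level, since one such incidence alone is an acyclic compatible matching
(`FilteredMatching.single`).

In a complex of the second kind every boundary in `K_j` is already a cycle of `K_{j-1}`. Writing Z
and B for the cycles and boundaries of the whole complex, the multiplicities then telescope to `p =
∑ dim B_d` and `k = ∑ (dim Z_d - dim B_d)`, while rank-nullity counts `∑ (dim Z_d + dim B_d) = 2p +
k` cells (`card_cells_of_reduced`).

Minimality follows from the same count: any competitor can itself be reduced by some vital strategy,
which keeps its barcode, never adds cells and ends with `2p + k` of them.

Chains are row vectors, so a matrix product acts from left to right. -/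

/-- The Schur complement `C * S * C` of the matched block is a deformation retract of `D`, with
inclusion `C + C * D * h`, projection `C + h * D * C` and homotopy `h`. -/
theorem schur_retract {R : Type*} [Ring R] (D P Q D' C L U : R) (n : ℕ)
    (hD : D * D = 0) (hD' : D = D' + P) (hsum : C + L + U = 1)
    (hLQ : L * Q = Q) (hQU : Q * U = Q) (hPL : P * L = P) (hUP : U * P = P)
    (hQP : Q * P = -L) (hPQ : P * Q = -U) (hCP : C * P = 0) (hPC : P * C = 0)
    (hCC : C * C = C) (hCL : C * L = 0) (hUC : U * C = 0) (hUL : U * L = 0)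
    (hnil : (Q * D') ^ n = 0) (S h : R)
    (hSdef : S = ∑ k ∈ Finset.range (n + 1), D' * (Q * D') ^ k)
    (hh : h = (∑ k ∈ Finset.range n, (Q * D') ^ k) * Q) :
    (C * S * C) * (C + C * D * h) = (C + C * D * h) * D ∧
    D * (C + h * D * C) = (C + h * D * C) * (C * S * C) ∧
    (C + C * D * h) * (C + h * D * C) = C ∧
    (C + h * D * C) * (C + C * D * h) = 1 + D * h + h * D := by
  -- By nilpotency the finite geometric series `g` is a two-sided inverse of `1 - Q * D'`.
  obtain ⟨g, hg⟩ : ∃ g, g = ∑ k ∈ Finset.range n, (Q * D') ^ k := ⟨_, rfl⟩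
  rw [← hg] at hh
  have hg1 : g * (Q * D') = g - 1 := by
    have h := geom_sum_mul (Q * D') n
    rw [← hg, hnil, mul_sub, mul_one] at h
    rw [sub_eq_iff_eq_add] at h
    rw [h]; abel
  have hg2 : (Q * D') * g = g - 1 := by
    have h := mul_geom_sum (Q * D') n
    rw [← hg, hnil, sub_mul, one_mul] at h
    rw [sub_eq_iff_eq_add] at h
    rw [h]; abel
  have hS : S = D' + D' * h * D' := by
    have : S = D' * g := by
      simp only [hSdef, Finset.sum_range_succ, hnil, mul_zero, add_zero, hg, Finset.mul_sum]
    rw [this, hh]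
    have : D' * (g * Q) * D' = D' * (g * (Q * D')) := by noncomm_ring
    rw [this, hg1]; noncomm_ring
  have hgQ : g * Q = Q + Q * D' * g * Q := by
    rw [hg2]; noncomm_ring
  have hLh : L * h = h := by
    rw [hh, hgQ, mul_add, hLQ]
    congr 1
    calc L * (Q * D' * g * Q) = (L * Q) * D' * g * Q := by noncomm_ring
      _ = _ := by rw [hLQ]
  have hhU : h * U = h := by rw [hh, mul_assoc, hQU]
  -- Up to sign, `h` inverts the full `D` on the matched block, not only its matched part `P`; `e1`
  -- and `e2` are the two sides of this.
  have e1 : h * D * L = -L := by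
    have : h * D * L = (g * (Q * D')) * L + g * (Q * (P * L)) := by
      rw [hh, hD']; noncomm_ring
    rw [this, hg1, hPL, hQP]; noncomm_ring
  have e2 : U * D * h = -U := by
    have : U * D * h = U * (D' * g * Q) + (U * P) * g * Q := by
      rw [hh, hD']; noncomm_ring
    rw [this, hUP]
    have hp : P * g * Q = P * Q + P * Q * D' * g * Q := by
      calc P * g * Q = P * (g * Q) := by noncomm_ring
        _ = P * (Q + Q * D' * g * Q) := by rw [← hgQ]
        _ = _ := by noncomm_ring
    rw [hp, hPQ]; noncomm_ring
  have hCh : C * h = 0 := by rw [← hLh, ← mul_assoc, hCL, zero_mul]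
  have hhC : h * C = 0 := by rw [← hhU, mul_assoc, hUC, mul_zero]
  have hhL : h * L = 0 := by rw [← hhU, mul_assoc, hUL, mul_zero]
  have hUh : U * h = 0 := by rw [← hLh, ← mul_assoc, hUL, zero_mul]
  have hhh : h * h = 0 := by
    calc h * h = h * (L * h) := by rw [hLh]
      _ = h * L * h := by rw [mul_assoc]
      _ = 0 := by rw [hhL, zero_mul]
  have hhDh : h * D * h = -h := by
    calc h * D * h = h * D * L * h := by rw [mul_assoc (h * D), hLh]
      _ = -h := by rw [e1, neg_mul, hLh]
  -- `π` is the chain map homotopic to the identity through `h`. It is idempotent and satisfies `π *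
  -- L = 0` and `U * π = 0`, so inserting `1 = C + L + U` between two copies of it leaves `π * C * π
  -- = π`. Inclusion, projection and Morse boundary are `C * π`, `π * C` and `C * D * π * C`, and
  -- the four identities become formal.
  obtain ⟨π, hπ⟩ : ∃ π, π = 1 + D * h + h * D := ⟨_, rfl⟩
  have hπL : π * L = 0 := by
    have : π * L = L + D * (h * L) + h * D * L := by rw [hπ]; noncomm_ring
    rw [this, hhL, e1]; noncomm_ring
  have hUπ : U * π = 0 := by
    have : U * π = U + U * D * h + U * h * D := by rw [hπ]; noncomm_ring
    rw [this, hUh, e2]; noncomm_ring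
  have hππ : π * π = π := by
    have : π * π = 1 + D * h + h * D + D * h + h * D + D * (h * D * h) + (h * D * h) * D
        + D * (h * h) * D + h * (D * D) * h := by rw [hπ]; noncomm_ring
    rw [this, hhDh, hhh, hD, hπ]; noncomm_ring
  have hπCπ : π * C * π = π := by
    have hC : C = 1 - L - U := by rw [← hsum]; abel
    have : π * C * π = π * π - (π * L) * π - π * (U * π) := by rw [hC]; noncomm_ring
    rw [this, hπL, hUπ, hππ]; simp
  have hDπ : D * π = D + D * h * D := by
    have : D * π = D + (D * D) * h + D * h * D := by rw [hπ]; noncomm_ring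
    rw [this, hD]; simp
  have hπD : π * D = D * π := by
    have : π * D = D + D * h * D + h * (D * D) := by rw [hπ]; noncomm_ring
    rw [this, hDπ, hD]; simp
  have hj : C + C * D * h = C * π := by
    have : C * π = C + C * D * h + (C * h) * D := by rw [hπ]; noncomm_ring
    rw [this, hCh]; simp
  have hp : C + h * D * C = π * C := by
    have : π * C = C + D * (h * C) + h * D * C := by rw [hπ]; noncomm_ring
    rw [this, hhC]; simp
  have hCD : C * D' = C * D := by rw [hD', mul_add, hCP, add_zero]
  have hDC : D' * C = D * C := by rw [hD', add_mul, hPC, add_zero]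
  have hCSC : C * S * C = C * (D * π) * C := by
    rw [hS, hDπ]
    calc C * (D' + D' * h * D') * C = C * D' * C + (C * D') * h * (D' * C) := by noncomm_ring
      _ = C * D * C + (C * D) * h * (D * C) := by rw [hCD, hDC]
      _ = _ := by noncomm_ring
  rw [hj, hp, hCSC, ← hπ]
  refine ⟨?_, ?_, ?_, ?_⟩
  · calc C * (D * π) * C * (C * π) = C * D * (π * (C * C) * π) := by noncomm_ring
      _ = C * (D * π) := by rw [hCC, hπCπ, mul_assoc]
      _ = C * π * D := by rw [← hπD, mul_assoc]
  · calc D * (π * C) = (D * π) * C := by rw [mul_assoc]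
      _ = π * D * C := by rw [hπD]
      _ = (π * C * π) * D * C := by rw [hπCπ]
      _ = π * C * (π * D) * C := by noncomm_ring
      _ = π * (C * C) * (D * π) * C := by rw [hCC, hπD]
      _ = _ := by noncomm_ring
  · calc C * π * (π * C) = C * (π * π) * C := by noncomm_ring
      _ = (C + C * D * h) * C := by rw [hππ, hj]
      _ = C * C + C * D * (h * C) := by noncomm_ring
      _ = C := by rw [hhC, hCC]; simp
  · calc π * C * (C * π) = π * (C * C) * π := by noncomm_ring
      _ = π := by rw [hCC, hπCπ]

/-! ### The deformation retraction onto the Morse complex -/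

namespace FilteredMatching

variable {F : Type*} [Field F] {ι : Type*} [Fintype ι] [DecidableEq ι]
  {K : FilteredComplex F ι} (m : FilteredMatching K)

/-- The chain homotopy of a matching: the path sums from a face to a matched cell. -/
noncomputable def homotopy : Matrix ι ι F :=
  (∑ k ∈ Finset.range (Fintype.card ι), (m.up * m.down) ^ k) * m.up

open scoped Classical in
/-- The projection onto the span of the unmatched elements. -/
noncomputable def unmatchedProj : Matrix ι ι F :=
  Matrix.diagonal fun x => if m.Matched x then 0 else 1

/-- The inclusion of the Morse complex. -/
noncomputable def morseIncl : Matrix ι ι F :=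
  m.unmatchedProj + m.unmatchedProj * K.inc * m.homotopy

/-- The projection to the Morse complex. -/
noncomputable def morseProj : Matrix ι ι F :=
  m.unmatchedProj + m.homotopy * K.inc * m.unmatchedProj

/-- `schur_retract` applied to the splitting into unmatched indices (`C`), lower partners (`L`) and
upper partners (`U`). Uniqueness of partners makes the matched part `P` of the boundary a monomial
matrix from `U` to `L`, with negative inverse `m.up`. -/
theorem morse_retract :
    m.morseInc * m.morseIncl = m.morseIncl * K.inc ∧
    K.inc * m.morseProj = m.morseProj * m.morseInc ∧
    m.morseIncl * m.morseProj = m.unmatchedProj ∧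
    m.morseProj * m.morseIncl = 1 + K.inc * m.homotopy + m.homotopy * K.inc := by
  classical
  let P : Matrix ι ι F := Matrix.of fun A b => if m.pair b A then K.inc A b else 0
  let L : Matrix ι ι F := Matrix.diagonal fun x => if ∃ A, m.pair x A then 1 else 0
  let U : Matrix ι ι F := Matrix.diagonal fun x => if ∃ b, m.pair b x then 1 else 0
  obtain ⟨C, hCdef⟩ : ∃ C : Matrix ι ι F,
    C = Matrix.diagonal fun x => if m.Matched x then 0 else 1 := ⟨_, rfl⟩
  have hU : m.unmatchedProj = C := by rw [hCdef]; rfl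
  have hD' : K.inc = m.down + P := by
    ext A b
    by_cases h : m.pair b A <;> simp [P, down, h]
  have hsum : C + L + U = 1 := by
    rw [hCdef, ← Matrix.diagonal_one, Matrix.diagonal_add, Matrix.diagonal_add]
    congr 1
    ext x
    by_cases h1 : ∃ A, m.pair x A <;> by_cases h2 : ∃ b, m.pair b x
    · obtain ⟨A, hA⟩ := h1
      obtain ⟨b, hb⟩ := h2
      exact absurd hA (m.not_both _ _ _ hb)
    all_goals simp [Matched, h1, h2]
  have hLQ : L * m.up = m.up := by
    ext x y
    by_cases h : m.pair x y
    · have : ∃ A, m.pair x A := ⟨y, h⟩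
      simp [L, Matrix.diagonal_mul, this]
    · simp [L, Matrix.diagonal_mul, up, h]
  have hQU : m.up * U = m.up := by
    ext x y
    by_cases h : m.pair x y
    · have : ∃ b, m.pair b y := ⟨x, h⟩
      simp [U, Matrix.mul_diagonal, this]
    · simp [U, Matrix.mul_diagonal, up, h]
  have hPL : P * L = P := by
    ext x y
    by_cases h : m.pair y x
    · have : ∃ A, m.pair y A := ⟨x, h⟩
      simp [L, Matrix.mul_diagonal, this]
    · simp [L, P, Matrix.mul_diagonal, h]
  have hUP : U * P = P := by
    ext x y
    by_cases h : m.pair y x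
    · have : ∃ b, m.pair b x := ⟨y, h⟩
      simp [U, Matrix.diagonal_mul, this]
    · simp [U, P, Matrix.diagonal_mul, h]
  have hCP : C * P = 0 := by
    ext x y
    by_cases h : m.pair y x
    · have : m.Matched x := Or.inr ⟨y, h⟩
      simp [hCdef, Matrix.diagonal_mul, this]
    · simp [P, hCdef, Matrix.diagonal_mul, h]
  have hPC : P * C = 0 := by
    ext x y
    by_cases h : m.pair y x
    · have : m.Matched y := Or.inl ⟨x, h⟩
      simp [hCdef, Matrix.mul_diagonal, this]
    · simp [P, hCdef, Matrix.mul_diagonal, h]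
  have hQP : m.up * P = -L := by
    ext x y
    rw [Matrix.mul_apply]
    by_cases h : ∃ A, m.pair x A
    · obtain ⟨A, hA⟩ := h
      rw [Finset.sum_eq_single A]
      · by_cases hxy : x = y
        · subst hxy
          have h0 := m.inc_ne_zero _ _ hA
          have h1 : ∃ A, m.pair x A := ⟨A, hA⟩
          simp [up, P, L, hA, h0, h1]
        · have : ¬ m.pair y A := fun h => hxy (m.down_unique _ _ _ hA h)
          simp [P, L, this, hxy]
      · intro B _ hB
        have : ¬ m.pair x B := fun h => hB (m.up_unique _ _ _ h hA)
        simp [up, this]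
      · simp
    · have h' : ∀ A, ¬ m.pair x A := fun A hA => h ⟨A, hA⟩
      simp [up, L, h', Matrix.diagonal_apply]
  have hPQ : P * m.up = -U := by
    ext x y
    rw [Matrix.mul_apply]
    by_cases h : ∃ b, m.pair b x
    · obtain ⟨b, hb⟩ := h
      rw [Finset.sum_eq_single b]
      · by_cases hxy : x = y
        · subst hxy
          have h0 := m.inc_ne_zero _ _ hb
          have h1 : ∃ b, m.pair b x := ⟨b, hb⟩
          simp [up, P, U, hb, h0, h1]
        · have : ¬ m.pair b y := fun h => hxy (m.up_unique _ _ _ hb h)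
          simp [up, U, this, hxy]
      · intro c _ hc
        have : ¬ m.pair c x := fun h => hc (m.down_unique _ _ _ h hb)
        simp [P, this]
      · simp
    · have h' : ∀ b, ¬ m.pair b x := fun b hb => h ⟨b, hb⟩
      simp [P, U, h', Matrix.diagonal_apply]
  have hCC : C * C = C := by
    simp [hCdef, Matrix.diagonal_mul_diagonal]
  have hCL : C * L = 0 := by
    rw [hCdef, Matrix.diagonal_mul_diagonal, ← Matrix.diagonal_zero]
    congr 1
    ext x
    by_cases h : ∃ A, m.pair x A <;> simp [Matched, h]
  have hUC : U * C = 0 := by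
    rw [hCdef, Matrix.diagonal_mul_diagonal, ← Matrix.diagonal_zero]
    congr 1
    ext x
    by_cases h : ∃ b, m.pair b x <;> simp [Matched, h]
  have hUL : U * L = 0 := by
    rw [Matrix.diagonal_mul_diagonal, ← Matrix.diagonal_zero]
    congr 1
    ext x
    by_cases h2 : ∃ b, m.pair b x
    · have h1 : ¬ ∃ A, m.pair x A := fun ⟨A, hA⟩ => h2.elim fun b hb => m.not_both _ _ _ hb hA
      simp [h1]
    · simp [h2]
  have hM : m.morseInc = C * m.pathSum * C := by
    -- `C` also fixes the indices outside `K.cells`, whereas `morseInc` keeps critical cells only;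
    -- the two restrictions agree because path sums vanish off `K.cells`.
    have hout : ∀ A b, m.pathSum A b ≠ 0 → A ∈ K.cells ∧ b ∈ K.cells := by
      intro A b h
      unfold pathSum at h
      rw [Matrix.sum_apply] at h
      obtain ⟨k, -, hk⟩ := Finset.exists_ne_zero_of_sum_ne_zero h
      constructor
      · rw [Matrix.mul_apply] at hk
        obtain ⟨z, -, hz⟩ := Finset.exists_ne_zero_of_sum_ne_zero hk
        exact (K.mem_of_inc _ _ (m.down_ne_zero (left_ne_zero_of_mul hz)).1).1
      · rw [show m.down * (m.up * m.down) ^ k = (m.down * m.up) ^ k * m.down from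
          (mul_pow_mul _ _ _).symm, Matrix.mul_apply] at hk
        obtain ⟨z, -, hz⟩ := Finset.exists_ne_zero_of_sum_ne_zero hk
        exact (K.mem_of_inc _ _ (m.down_ne_zero (right_ne_zero_of_mul hz)).1).2
    ext A b
    by_cases h0 : m.pathSum A b = 0
    · simp [morseInc, hCdef, Matrix.diagonal_mul, Matrix.mul_diagonal, h0]
    · obtain ⟨hA, hb⟩ := hout A b h0
      by_cases h1 : m.Matched A <;> by_cases h2 : m.Matched b <;>
        simp [morseInc, critical, hCdef, Matrix.diagonal_mul, Matrix.mul_diagonal, hA, hb, h1, h2]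
  have := schur_retract K.inc P m.up m.down C L U (Fintype.card ι) K.inc_mul_inc hD' hsum hLQ
    hQU hPL hUP hQP hPQ hCP hPC hCC hCL hUC hUL m.pow_up_mul_down_eq_zero m.pathSum m.homotopy
    rfl rfl
  unfold morseIncl morseProj
  rw [hM, hU]
  exact this

/-- This makes the homotopy filtered: V-paths descend in level, and by compatibility the final step
up to a matched partner stays at its level. -/
theorem homotopy_ne_zero {x y : ι} (h : m.homotopy x y ≠ 0) :
    y ∈ K.cells ∧ K.dim y = K.dim x + 1 ∧ K.lvl y ≤ K.lvl x := by
  rw [homotopy, Matrix.mul_apply] at h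
  obtain ⟨z, -, hz⟩ := Finset.exists_ne_zero_of_sum_ne_zero h
  have hp := m.up_ne_zero (right_ne_zero_of_mul hz)
  have h1 := left_ne_zero_of_mul hz
  rw [Matrix.sum_apply] at h1
  obtain ⟨k, -, hk⟩ := Finset.exists_ne_zero_of_sum_ne_zero h1
  obtain ⟨h2, h3⟩ := m.pow_up_mul_down_ne_zero k hk
  have hi := m.inc_ne_zero _ _ hp
  have d := K.dim_of_inc _ _ hi
  have l := m.compatible _ _ hp
  exact ⟨(K.mem_of_inc _ _ hi).1, by omega, by omega⟩

end FilteredMatching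

/-! ### Chains and persistent Betti numbers as ranks -/

namespace FilteredComplex

section Chains

variable {F : Type*} [Field F] {ι : Type*} [Fintype ι] (K : FilteredComplex F ι)

theorem boundary_apply (c : ι → F) : K.boundary c = c ᵥ* K.inc := rfl

theorem mem_chains {d : ℕ} {t : WithTop ℤ} {c : ι → F} :
    c ∈ K.chains d t ↔ ∀ x, c x ≠ 0 → x ∈ K.cells ∧ K.dim x = d ∧ (K.lvl x : WithTop ℤ) ≤ t :=
  Iff.rfl

theorem vecMul_ne_zero {c : ι → F} {M : Matrix ι ι F} {y : ι} (h : (c ᵥ* M) y ≠ 0) :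
    ∃ x, c x ≠ 0 ∧ M x y ≠ 0 := by
  obtain ⟨x, -, hx⟩ := Finset.exists_ne_zero_of_sum_ne_zero h
  exact ⟨x, left_ne_zero_of_mul hx, right_ne_zero_of_mul hx⟩

theorem boundary_mem_chains {d : ℕ} {t : WithTop ℤ} {c : ι → F} (hc : c ∈ K.chains (d + 1) t) :
    c ᵥ* K.inc ∈ K.chains d t := by
  intro y hy
  obtain ⟨x, hx, hxy⟩ := vecMul_ne_zero hy
  obtain ⟨-, h2, h3⟩ := hc x hx
  have h4 := K.dim_of_inc _ _ hxy
  exact ⟨(K.mem_of_inc _ _ hxy).2, by omega,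
    (WithTop.coe_le_coe.2 (K.lvl_of_inc _ _ hxy)).trans h3⟩

theorem boundary_eq_zero_of_dim_zero {t : WithTop ℤ} {c : ι → F} (hc : c ∈ K.chains 0 t) :
    c ᵥ* K.inc = 0 := by
  ext y
  by_contra hy
  obtain ⟨x, hx, hxy⟩ := vecMul_ne_zero hy
  have h4 := K.dim_of_inc _ _ hxy
  have := (hc x hx).2.1
  omega

theorem boundary_boundary (c : ι → F) : K.boundary (K.boundary c) = 0 := by
  simp [boundary_apply, Matrix.vecMul_vecMul, K.inc_mul_inc]

theorem boundaries_le_cycles (d : ℕ) (t : WithTop ℤ) : K.boundaries d t ≤ K.cycles d t := by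
  rintro _ ⟨c, hc, rfl⟩
  exact ⟨K.boundary_mem_chains hc, K.boundary_boundary c⟩

/-- Trades the subquotients for the image of the cycles in the quotient of the whole chain space by
the boundaries. Both maps out of the cycles at `s` have as kernel those that bound at `t`, so their
ranks agree. -/
theorem persistentBetti_eq_finrank_map (d : ℕ) {s t : WithTop ℤ} (h : s ≤ t) :
    K.persistentBetti d s t =
      Module.finrank F ((K.cycles d s).map (K.boundaries d t).mkQ) := by
  let f : K.cycles d s →ₗ[F] K.Homology d t :=
    Submodule.mkQ _ ∘ₗ Submodule.inclusion (K.cycles_mono d h)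
  let g : K.cycles d s →ₗ[F] (ι → F) ⧸ K.boundaries d t :=
    (K.boundaries d t).mkQ ∘ₗ (K.cycles d s).subtype
  have hf : LinearMap.range (K.homologyMap d h) = LinearMap.range f := by
    rw [← LinearMap.range_comp_of_range_eq_top (K.homologyMap d h)
      (Submodule.range_mkQ ((K.boundaries d s).submoduleOf (K.cycles d s)))]
    rfl
  have hg : (K.cycles d s).map (K.boundaries d t).mkQ = LinearMap.range g := by
    rw [LinearMap.range_comp, Submodule.range_subtype]
  have hk : LinearMap.ker f = LinearMap.ker g := by
    ext x
    simp only [f, g, LinearMap.mem_ker, LinearMap.comp_apply, Submodule.mkQ_apply,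
      Submodule.Quotient.mk_eq_zero]
    rfl
  have h1 := f.finrank_range_add_finrank_ker
  have h2 := g.finrank_range_add_finrank_ker
  rw [hk] at h1
  rw [persistentBetti, dif_pos h, hf, hg]
  omega

/-- One half of a comparison: `g` descends to the quotients by boundaries, and its image covers
every class of `K` coming from level `s`. Invariance uses it once in each direction. -/
theorem persistentBetti_le_of_map {ι' : Type*} [Fintype ι'] (L : FilteredComplex F ι') (d : ℕ)
    {s t : WithTop ℤ} (h : s ≤ t) (g : (ι' → F) →ₗ[F] (ι → F))
    (hg : L.boundaries d t ≤ (K.boundaries d t).comap g)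
    (hz : ∀ z ∈ K.cycles d s, ∃ w ∈ L.cycles d s, z - g w ∈ K.boundaries d t) :
    K.persistentBetti d s t ≤ L.persistentBetti d s t := by
  rw [persistentBetti_eq_finrank_map _ _ h, persistentBetti_eq_finrank_map _ _ h]
  have hle : (K.cycles d s).map (K.boundaries d t).mkQ ≤
      ((L.cycles d s).map (L.boundaries d t).mkQ).map (Submodule.mapQ _ _ g hg) := by
    rintro _ ⟨z, hzc, rfl⟩
    obtain ⟨w, hw, hd⟩ := hz z hzc
    refine ⟨_, ⟨w, hw, rfl⟩, ?_⟩
    simp only [Submodule.mkQ_apply, Submodule.mapQ_apply]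
    exact ((Submodule.Quotient.eq _).2 hd).symm
  exact (Submodule.finrank_mono hle).trans (Submodule.finrank_map_le _ _)

end Chains

/-! ### Invariance of persistent Betti numbers under Morse reduction -/

section MorseInvariance

variable {F : Type*} [Field F] {ι : Type*} [Fintype ι] [DecidableEq ι]
  (K : FilteredComplex F ι) (m : FilteredMatching K)

theorem homotopy_mem_chains {d : ℕ} {t : WithTop ℤ} {c : ι → F} (hc : c ∈ K.chains d t) :
    c ᵥ* m.homotopy ∈ K.chains (d + 1) t := by
  intro y hy
  obtain ⟨x, hx, hxy⟩ := vecMul_ne_zero hy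
  obtain ⟨-, h2, h3⟩ := hc x hx
  obtain ⟨h4, h5, h6⟩ := m.homotopy_ne_zero hxy
  exact ⟨h4, by omega, (WithTop.coe_le_coe.2 h6).trans h3⟩

theorem unmatchedProj_mem_chains {d : ℕ} {t : WithTop ℤ} {c : ι → F} (hc : c ∈ K.chains d t) :
    c ᵥ* m.unmatchedProj ∈ (K.morseComplex m).chains d t := by
  classical
  intro y hy
  rw [FilteredMatching.unmatchedProj, Matrix.vecMul_diagonal] at hy
  have h1 := hc y (left_ne_zero_of_mul hy)
  have h2 := right_ne_zero_of_mul hy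
  have h3 : ¬ m.Matched y := fun h => h2 (if_pos h)
  exact ⟨Finset.mem_filter.2 ⟨h1.1, h3⟩, h1.2⟩

theorem morseComplex_chains_le (d : ℕ) (t : WithTop ℤ) :
    (K.morseComplex m).chains d t ≤ K.chains d t := by
  classical
  intro c hc x hx
  exact ⟨(Finset.mem_filter.1 (hc x hx).1).1, (hc x hx).2⟩

theorem vecMul_unmatchedProj {d : ℕ} {t : WithTop ℤ} {c : ι → F}
    (hc : c ∈ (K.morseComplex m).chains d t) : c ᵥ* m.unmatchedProj = c := by
  classical
  ext x
  rw [FilteredMatching.unmatchedProj, Matrix.vecMul_diagonal]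
  by_cases h : c x = 0
  · simp [h]
  · have := (Finset.mem_filter.1 (hc x h).1).2
    rw [if_neg this, mul_one]

theorem morseProj_mem_chains {d : ℕ} {t : WithTop ℤ} {c : ι → F} (hc : c ∈ K.chains d t) :
    c ᵥ* m.morseProj ∈ (K.morseComplex m).chains d t := by
  rw [FilteredMatching.morseProj, Matrix.vecMul_add, ← Matrix.vecMul_vecMul,
    ← Matrix.vecMul_vecMul]
  exact add_mem (K.unmatchedProj_mem_chains m hc)
    (K.unmatchedProj_mem_chains m (K.boundary_mem_chains (K.homotopy_mem_chains m hc)))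

theorem morseIncl_mem_chains {d : ℕ} {t : WithTop ℤ} {c : ι → F}
    (hc : c ∈ (K.morseComplex m).chains d t) : c ᵥ* m.morseIncl ∈ K.chains d t := by
  rw [FilteredMatching.morseIncl, Matrix.vecMul_add, ← Matrix.vecMul_vecMul,
    ← Matrix.vecMul_vecMul, K.vecMul_unmatchedProj m hc]
  have hc' := K.morseComplex_chains_le m d t hc
  refine add_mem hc' ?_
  -- The correction term lowers the dimension before raising it again; in dimension 0 it vanishes.
  cases d with
  | zero => rw [K.boundary_eq_zero_of_dim_zero hc', Matrix.zero_vecMul]; exact zero_mem _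
  | succ d => exact K.homotopy_mem_chains m (K.boundary_mem_chains hc')

/-- A filtered Morse complex has the same persistent Betti numbers. -/
theorem persistentBetti_morseComplex (d : ℕ) (s t : WithTop ℤ) :
    (K.morseComplex m).persistentBetti d s t = K.persistentBetti d s t := by
  by_cases h : s ≤ t
  swap
  · simp [persistentBetti, h]
  obtain ⟨h1, h2, h3, h4⟩ := m.morse_retract
  have hinc : (K.morseComplex m).inc = m.morseInc := rfl
  apply le_antisymm
  · refine persistentBetti_le_of_map _ K d h m.morseProj.vecMulLinear ?_ ?_
    · rintro _ ⟨c, hc, rfl⟩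
      refine ⟨c ᵥ* m.morseProj, K.morseProj_mem_chains m hc, ?_⟩
      rw [Matrix.vecMulLinear_apply, boundary_apply, boundary_apply, Matrix.vecMul_vecMul,
        Matrix.vecMul_vecMul, h2, hinc]
    -- Inclusion followed by projection is the identity on Morse chains, so no boundary is needed.
    · rintro z ⟨hz, hz0⟩
      refine ⟨z ᵥ* m.morseIncl, ⟨K.morseIncl_mem_chains m hz, ?_⟩, ?_⟩
      · rw [SetLike.mem_coe, LinearMap.mem_ker, boundary_apply, hinc] at hz0
        rw [SetLike.mem_coe, LinearMap.mem_ker, boundary_apply, Matrix.vecMul_vecMul, ← h1,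
          ← Matrix.vecMul_vecMul, hz0, Matrix.zero_vecMul]
      · rw [Matrix.vecMulLinear_apply, Matrix.vecMul_vecMul, h3, K.vecMul_unmatchedProj m hz,
          sub_self]
        exact zero_mem _
  · refine persistentBetti_le_of_map _ (K.morseComplex m) d h m.morseIncl.vecMulLinear ?_ ?_
    · rintro _ ⟨c, hc, rfl⟩
      refine ⟨c ᵥ* m.morseIncl, K.morseIncl_mem_chains m hc, ?_⟩
      rw [Matrix.vecMulLinear_apply, boundary_apply, boundary_apply, Matrix.vecMul_vecMul,
        Matrix.vecMul_vecMul, hinc, h1]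
    · rintro z ⟨hz, hz0⟩
      rw [SetLike.mem_coe, LinearMap.mem_ker, boundary_apply] at hz0
      refine ⟨z ᵥ* m.morseProj, ⟨K.morseProj_mem_chains m hz, ?_⟩, ?_⟩
      · rw [SetLike.mem_coe, LinearMap.mem_ker, boundary_apply, hinc, Matrix.vecMul_vecMul, ← h2,
          ← Matrix.vecMul_vecMul, hz0, Matrix.zero_vecMul]
      -- For a cycle `z` the homotopy identity reduces to `z * π = z + ∂(z * h)`, so `-(z * h)`
      -- bounds the difference.
      · refine ⟨-(z ᵥ* m.homotopy),
          neg_mem (K.homotopy_mem_chains m (K.chains_mono d h hz)), ?_⟩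
        rw [Matrix.vecMulLinear_apply, Matrix.vecMul_vecMul, h4, Matrix.vecMul_add,
          Matrix.vecMul_add, Matrix.vecMul_one, ← Matrix.vecMul_vecMul, hz0, Matrix.zero_vecMul,
          map_neg, boundary_apply, Matrix.vecMul_vecMul]
        abel

end MorseInvariance

end FilteredComplex

/-! ### Dimension counts and telescoping sums -/

theorem Submodule.finrank_map_add_finrank_inf_ker {F V W : Type*} [Field F] [AddCommGroup V]
    [Module F V] [FiniteDimensional F V] [AddCommGroup W] [Module F W] (f : V →ₗ[F] W)
    (p : Submodule F V) :
    Module.finrank F (p.map f) + Module.finrank F (p ⊓ LinearMap.ker f : Submodule F V) =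
      Module.finrank F p := by
  rw [← (f.comp p.subtype).finrank_range_add_finrank_ker, LinearMap.range_comp,
    Submodule.range_subtype, LinearMap.ker_comp, ← Submodule.map_comap_subtype,
    Submodule.finrank_map_subtype_eq]

/-- The dimension of intersections of subspaces is supermodular. -/
theorem Submodule.finrank_inf_supermodular {F V : Type*} [Field F] [AddCommGroup V] [Module F V]
    [FiniteDimensional F V] {Z' Z B' B : Submodule F V} (hZ : Z' ≤ Z) (hB : B' ≤ B) :
    Module.finrank F (Z ⊓ B' : Submodule F V) + Module.finrank F (Z' ⊓ B : Submodule F V) ≤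
      Module.finrank F (Z ⊓ B : Submodule F V) + Module.finrank F (Z' ⊓ B' : Submodule F V) := by
  rw [← Submodule.finrank_sup_add_finrank_inf_eq]
  have h1 : Z ⊓ B' ⊓ (Z' ⊓ B) = Z' ⊓ B' :=
    le_antisymm (le_inf (inf_le_right.trans inf_le_left) (inf_le_left.trans inf_le_right))
      (le_inf (inf_le_inf_right _ hZ) (inf_le_inf_left _ hB))
  rw [h1]
  gcongr
  exact Submodule.finrank_mono (sup_le (inf_le_inf_left _ hB) (inf_le_inf_right _ hZ))

theorem Finset.sum_Ico_sub_pred {M : Type*} [AddCommGroup M] (f : ℤ → M) {a b : ℤ} (h : a ≤ b) :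
    ∑ i ∈ Finset.Ico a b, (f i - f (i - 1)) = f (b - 1) - f (a - 1) := by
  induction b, h using Int.leInduction with
  | base => simp
  | succ b hb ih =>
    rw [← Finset.insert_Ico_right_eq_Ico_add_one hb, Finset.sum_insert (by simp), ih]
    simp

theorem Finset.sum_Icc_sub_pred {M : Type*} [AddCommGroup M] (f : ℤ → M) {a b : ℤ} (h : a ≤ b) :
    ∑ i ∈ Finset.Icc a b, (f i - f (i - 1)) = f b - f (a - 1) := by
  have h1 : Finset.Icc a b = Finset.Ico a (b + 1) := by ext; simp
  rw [h1, Finset.sum_Ico_sub_pred f (by omega)]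
  simp

/-! ### Multiplicities as dimensions of intersections of cycles and boundaries -/

namespace FilteredComplex

variable {F : Type*} [Field F] {ι : Type*} [Fintype ι] (K : FilteredComplex F ι)

theorem persistentBetti_add_finrank (d : ℕ) {s t : WithTop ℤ} (h : s ≤ t) :
    K.persistentBetti d s t +
      Module.finrank F (K.cycles d s ⊓ K.boundaries d t : Submodule F (ι → F)) =
      Module.finrank F (K.cycles d s) := by
  rw [K.persistentBetti_eq_finrank_map d h]
  have := Submodule.finrank_map_add_finrank_inf_ker (K.boundaries d t).mkQ (K.cycles d s)
  rwa [Submodule.ker_mkQ] at this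

theorem finrank_cycles_add_finrank_boundaries (d : ℕ) (t : WithTop ℤ) :
    Module.finrank F (K.cycles (d + 1) t) + Module.finrank F (K.boundaries d t) =
      Module.finrank F (K.chains (d + 1) t) := by
  rw [← Submodule.finrank_map_add_finrank_inf_ker K.boundary (K.chains (d + 1) t), add_comm]
  rfl

theorem cycles_zero (t : WithTop ℤ) : K.cycles 0 t = K.chains 0 t :=
  inf_eq_left.2 fun _ hc => K.boundary_eq_zero_of_dim_zero hc

theorem finrank_chains_top (d : ℕ) :
    Module.finrank F (K.chains d ⊤) = (K.cells.filter fun x => K.dim x = d).card := by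
  classical
  let I : Finset ι := K.cells.filter fun x => K.dim x = d
  -- At level `⊤` the chains are cut out by the vanishing of all coordinates off `I`.
  have hI : K.chains d ⊤ = ⨅ i ∈ ((I : Set ι)ᶜ), LinearMap.ker (LinearMap.proj i : (ι → F) →ₗ[F] F) := by
    ext c
    simp only [mem_chains, le_top, and_true, Submodule.mem_iInf, LinearMap.mem_ker,
      LinearMap.proj_apply, Set.mem_compl_iff, Finset.mem_coe, I, Finset.mem_filter]
    exact forall_congr' fun x => not_imp_comm
  rw [hI, (LinearMap.iInfKerProjEquiv F (fun _ : ι => F) (I := (I : Set ι)) (J := (I : Set ι)ᶜ)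
    disjoint_compl_right (by simp)).finrank_eq]
  simp only [Module.finrank_fintype_fun_eq_card, Finset.coe_sort_coe, Fintype.card_coe, I]

theorem multiplicity_top (d : ℕ) (i : ℤ) : K.multiplicity d i ⊤ =
    (K.persistentBetti d i ⊤ : ℤ) - K.persistentBetti d ((i - 1 : ℤ) : WithTop ℤ) ⊤ := rfl

theorem coe_sub_one_le (i : ℤ) : ((i - 1 : ℤ) : WithTop ℤ) ≤ (i : WithTop ℤ) :=
  WithTop.coe_le_coe.2 (by omega)

/-- By rank-nullity each Betti number is `dim Z_s - dim (Z_s ⊓ B_t)`. The terms `dim Z_s` cancel in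
the second difference. -/
theorem multiplicity_coe_of_lt (d : ℕ) {i j : ℤ} (h : i < j) : K.multiplicity d i (j : WithTop ℤ) =
    ((Module.finrank F (K.cycles d i ⊓ K.boundaries d j : Submodule F (ι → F)) : ℤ) -
      Module.finrank F (K.cycles d i ⊓ K.boundaries d (j - 1 : ℤ) : Submodule F (ι → F))) -
    (Module.finrank F (K.cycles d (i - 1 : ℤ) ⊓ K.boundaries d j : Submodule F (ι → F)) -
      Module.finrank F
        (K.cycles d (i - 1 : ℤ) ⊓ K.boundaries d (j - 1 : ℤ) : Submodule F (ι → F))) := by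
  have h0 : K.multiplicity d i (j : WithTop ℤ) = if i < j then
      ((K.persistentBetti d i ((j - 1 : ℤ) : WithTop ℤ) : ℤ) - K.persistentBetti d i j)
        - ((K.persistentBetti d ((i - 1 : ℤ) : WithTop ℤ) ((j - 1 : ℤ) : WithTop ℤ) : ℤ)
          - K.persistentBetti d ((i - 1 : ℤ) : WithTop ℤ) j)
    else 0 := rfl
  rw [h0, if_pos h]
  have h1 := K.persistentBetti_add_finrank d (s := i) (t := j) (WithTop.coe_le_coe.2 (by omega))
  have h2 := K.persistentBetti_add_finrank d (s := i) (t := (j - 1 : ℤ))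
    (WithTop.coe_le_coe.2 (by omega))
  have h3 := K.persistentBetti_add_finrank d (s := (i - 1 : ℤ)) (t := j)
    (WithTop.coe_le_coe.2 (by omega))
  have h4 := K.persistentBetti_add_finrank d (s := (i - 1 : ℤ)) (t := (j - 1 : ℤ))
    (WithTop.coe_le_coe.2 (by omega))
  omega

theorem multiplicity_coe_of_le (d : ℕ) {i j : ℤ} (h : j ≤ i) :
    K.multiplicity d i (j : WithTop ℤ) = 0 :=
  if_neg (not_lt.2 h)

/-- Supermodularity of `dim (Z ⊓ B)` along the two filtrations. An infinite interval is the case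
where the larger `B` is the whole space. -/
theorem multiplicity_nonneg (d : ℕ) (i : ℤ) (j : WithTop ℤ) : 0 ≤ K.multiplicity d i j := by
  have hZ := K.cycles_mono d (coe_sub_one_le i)
  cases j with
  | top =>
    rw [multiplicity_top]
    have h1 := K.persistentBetti_add_finrank d (s := i) (t := ⊤) le_top
    have h2 := K.persistentBetti_add_finrank d (s := (i - 1 : ℤ)) (t := ⊤) le_top
    have h3 := Submodule.finrank_inf_supermodular hZ (le_top : K.boundaries d ⊤ ≤ ⊤)
    rw [inf_top_eq, inf_top_eq] at h3
    omega
  | coe j =>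
    by_cases h : i < j
    · rw [K.multiplicity_coe_of_lt d h]
      have := Submodule.finrank_inf_supermodular hZ (K.boundaries_mono d (coe_sub_one_le j))
      omega
    · rw [K.multiplicity_coe_of_le d (not_lt.1 h)]

theorem multiplicity_congr {ι' : Type*} [Fintype ι'] {L : FilteredComplex F ι'}
    (h : ∀ d s t, L.persistentBetti d s t = K.persistentBetti d s t) (d : ℕ) (i : ℤ)
    (j : WithTop ℤ) : L.multiplicity d i j = K.multiplicity d i j := by
  cases j <;> simp only [multiplicity, h]

/-- All dimensions and the absolute values of all levels are at most `N`. -/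
def BoundedBy (N : ℕ) : Prop := ∀ x, K.dim x ≤ N ∧ |K.lvl x| ≤ (N : ℤ)

theorem exists_boundedBy : ∃ N, K.BoundedBy N := by
  refine ⟨∑ x, (K.dim x + (K.lvl x).natAbs), fun x => ?_⟩
  have := Finset.single_le_sum (f := fun x => K.dim x + (K.lvl x).natAbs)
    (fun _ _ => Nat.zero_le _) (Finset.mem_univ x)
  rw [Int.abs_eq_natAbs]
  constructor <;> omega

/-! ### Stabilization outside a bounded range of levels and dimensions -/

section Bounded

variable {K} {N : ℕ} (hN : K.BoundedBy N)
include hN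

theorem BoundedBy.chains_of_le (d : ℕ) {t : ℤ} (ht : (N : ℤ) ≤ t) :
    K.chains d t = K.chains d ⊤ := by
  refine le_antisymm (K.chains_mono d le_top) fun c hc x hx => ⟨(hc x hx).1, (hc x hx).2.1, ?_⟩
  exact WithTop.coe_le_coe.2 ((le_abs_self _).trans ((hN x).2.trans ht))

theorem BoundedBy.chains_of_lt_neg (d : ℕ) {t : ℤ} (ht : t < -N) : K.chains d t = ⊥ := by
  refine (Submodule.eq_bot_iff _).2 fun c hc => ?_
  ext x
  by_contra hx
  have h1 := WithTop.coe_le_coe.1 (hc x hx).2.2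
  have h2 := abs_le.1 (hN x).2
  omega

theorem BoundedBy.chains_of_lt_dim {d : ℕ} (t : WithTop ℤ) (hd : N < d) : K.chains d t = ⊥ := by
  refine (Submodule.eq_bot_iff _).2 fun c hc => ?_
  ext x
  by_contra hx
  have h1 := (hc x hx).2.1
  have h2 := (hN x).1
  omega

theorem BoundedBy.cycles_of_le (d : ℕ) {t : ℤ} (ht : (N : ℤ) ≤ t) :
    K.cycles d t = K.cycles d ⊤ := by
  rw [cycles, cycles, hN.chains_of_le d ht]

theorem BoundedBy.boundaries_of_le (d : ℕ) {t : ℤ} (ht : (N : ℤ) ≤ t) :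
    K.boundaries d t = K.boundaries d ⊤ := by
  rw [boundaries, boundaries, hN.chains_of_le _ ht]

theorem BoundedBy.cycles_of_lt_neg (d : ℕ) {t : ℤ} (ht : t < -N) : K.cycles d t = ⊥ := by
  rw [cycles, hN.chains_of_lt_neg d ht, bot_inf_eq]

theorem BoundedBy.boundaries_of_lt_neg (d : ℕ) {t : ℤ} (ht : t < -N) :
    K.boundaries d t = ⊥ := by
  rw [boundaries, hN.chains_of_lt_neg _ ht, Submodule.map_bot]

theorem BoundedBy.cycles_of_lt_dim {d : ℕ} (t : WithTop ℤ) (hd : N < d) : K.cycles d t = ⊥ := by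
  rw [cycles, hN.chains_of_lt_dim t hd, bot_inf_eq]

theorem BoundedBy.multiplicity_top_ne_zero {d : ℕ} {i : ℤ} (h : K.multiplicity d i ⊤ ≠ 0) :
    d ≤ N ∧ -N ≤ i ∧ i ≤ N := by
  rw [multiplicity_top] at h
  have h1 := K.persistentBetti_add_finrank d (s := i) (t := ⊤) le_top
  have h2 := K.persistentBetti_add_finrank d (s := (i - 1 : ℤ)) (t := ⊤) le_top
  refine ⟨?_, ?_, ?_⟩ <;> by_contra hc <;> rw [not_le] at hc
  · rw [hN.cycles_of_lt_dim _ hc, finrank_bot] at h1 h2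
    omega
  · rw [hN.cycles_of_lt_neg d hc, finrank_bot] at h1
    rw [hN.cycles_of_lt_neg d (show i - 1 < -N by omega), finrank_bot] at h2
    omega
  · rw [hN.cycles_of_le d hc.le] at h1
    rw [hN.cycles_of_le d (show (N : ℤ) ≤ i - 1 by omega)] at h2
    omega

theorem BoundedBy.multiplicity_coe_ne_zero {d : ℕ} {i j : ℤ}
    (h : K.multiplicity d i (j : WithTop ℤ) ≠ 0) :
    d ≤ N ∧ (-N ≤ i ∧ i ≤ N) ∧ (-N ≤ j ∧ j ≤ N) := by
  have hij : i < j := by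
    by_contra hc
    exact h (K.multiplicity_coe_of_le d (not_lt.1 hc))
  rw [K.multiplicity_coe_of_lt d hij] at h
  have h1 : d ≤ N := by
    by_contra hc
    rw [not_le] at hc
    rw [hN.cycles_of_lt_dim _ hc, hN.cycles_of_lt_dim _ hc, bot_inf_eq, bot_inf_eq] at h
    exact h (by ring)
  have h2 : -N ≤ i := by
    by_contra hc
    rw [not_le] at hc
    rw [hN.cycles_of_lt_neg d hc, hN.cycles_of_lt_neg d (show i - 1 < -N by omega),
      bot_inf_eq, bot_inf_eq] at h
    exact h (by ring)
  have h3 : j ≤ N := by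
    by_contra hc
    rw [not_le] at hc
    rw [hN.boundaries_of_le d hc.le,
      hN.boundaries_of_le d (show (N : ℤ) ≤ j - 1 by omega)] at h
    exact h (by ring)
  omega

theorem BoundedBy.card_cells :
    K.cells.card = ∑ d ∈ Finset.range (N + 1),
      (Module.finrank F (K.cycles d ⊤) + Module.finrank F (K.boundaries d ⊤)) := by
  have h1 : K.cells.card = ∑ d ∈ Finset.range (N + 1), Module.finrank F (K.chains d ⊤) := by
    simp only [finrank_chains_top]
    exact Finset.card_eq_sum_card_fiberwise fun x _ => by
      have := (hN x).1
      simp only [Finset.coe_range, Set.mem_Iio]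
      omega
  -- Rank-nullity couples cycles in dimension `d + 1` with boundaries in dimension `d`, so the
  -- boundary sum is shifted by one; its spare last term vanishes, and in dimension 0 all chains are
  -- cycles.
  have h2 : Module.finrank F (K.boundaries N ⊤) = 0 := by
    rw [boundaries, hN.chains_of_lt_dim ⊤ (Nat.lt_succ_self N), Submodule.map_bot, finrank_bot]
  rw [h1, Finset.sum_add_distrib, Finset.sum_range_succ', Finset.sum_range_succ',
    Finset.sum_range_succ (fun d => Module.finrank F (K.boundaries d ⊤)), h2, cycles_zero]
  simp only [← finrank_cycles_add_finrank_boundaries, Finset.sum_add_distrib]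
  omega

end Bounded

/-- The multiplicities are nonnegative and vanish outside a finite box, hence are the counts of a
multiset. -/
theorem exists_isBarcode : ∃ B, K.IsBarcode B := by
  classical
  obtain ⟨N, hN⟩ := K.exists_boundedBy
  let S : Finset (ℕ × ℤ × WithTop ℤ) := Finset.range (N + 1) ×ˢ Finset.Icc (-N : ℤ) N ×ˢ
    (insert ⊤ ((Finset.Icc (-N : ℤ) N).image (fun j : ℤ => (j : WithTop ℤ))))
  refine ⟨∑ x ∈ S, (K.multiplicity x.1 x.2.1 x.2.2).toNat • {x}, fun d i j => ?_⟩
  have hS : K.multiplicity d i j ≠ 0 → (d, i, j) ∈ S := by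
    intro h
    simp only [S, Finset.mem_product, Finset.mem_range, Finset.mem_Icc, Finset.mem_insert,
      Finset.mem_image]
    cases j with
    | top =>
      have := hN.multiplicity_top_ne_zero h
      exact ⟨by omega, by omega, Or.inl rfl⟩
    | coe j =>
      have := hN.multiplicity_coe_ne_zero h
      exact ⟨by omega, by omega, Or.inr ⟨j, by omega, rfl⟩⟩
  rw [Multiset.count_sum']
  simp only [Multiset.count_nsmul, Multiset.count_singleton, mul_ite, mul_one, mul_zero]
  rw [Finset.sum_ite_eq]
  split_ifs with h
  · exact Int.toNat_of_nonneg (K.multiplicity_nonneg d i j)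
  · by_contra hc
    exact h (hS fun h0 => hc (by simp [h0]))

/-! ### Counting intervals and cells -/

section Count

variable {K} {N : ℕ} (hN : K.BoundedBy N) {B : Multiset (ℕ × ℤ × WithTop ℤ)} (hB : K.IsBarcode B)
include hN hB

/-- The sum over births telescopes from below level `-N`, where there are no cells, up to `N`, where
the complex is complete. -/
theorem BoundedBy.numInfinite_eq :
    (numInfinite B : ℤ) = ∑ d ∈ Finset.range (N + 1), (K.persistentBetti d ⊤ ⊤ : ℤ) := by
  classical
  let S : Finset (ℕ × ℤ × WithTop ℤ) := Finset.range (N + 1) ×ˢ Finset.Icc (-N : ℤ) N ×ˢ {⊤}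
  have hS : ∀ x ∈ B.filter (fun I => I.2.2 = ⊤), x ∈ S := by
    rintro ⟨d, i, j⟩ hx
    rw [Multiset.mem_filter] at hx
    obtain ⟨hx, rfl : j = ⊤⟩ := hx
    have h := hN.multiplicity_top_ne_zero (d := d) (i := i) (by
      rw [← hB]
      exact_mod_cast (Multiset.count_pos.2 hx).ne')
    simp only [S, Finset.mem_product, Finset.mem_range, Finset.mem_Icc, Finset.mem_singleton]
    exact ⟨by omega, by omega, trivial⟩
  rw [numInfinite, Multiset.countP_eq_card_filter, ← Multiset.sum_count_eq_card hS,
    Finset.sum_product, Nat.cast_sum]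
  refine Finset.sum_congr rfl fun d _ => ?_
  rw [Finset.sum_product, Nat.cast_sum]
  have h1 : ∀ i : ℤ, ((∑ j ∈ ({⊤} : Finset (WithTop ℤ)),
      (B.filter (fun I => I.2.2 = ⊤)).count (d, i, j) : ℕ) : ℤ) =
      (K.persistentBetti d i ⊤ : ℤ) - K.persistentBetti d ((i - 1 : ℤ) : WithTop ℤ) ⊤ := by
    intro i
    rw [Finset.sum_singleton, Multiset.count_filter_of_pos (p := fun I : ℕ × ℤ × WithTop ℤ => I.2.2 = ⊤) rfl, hB, multiplicity_top]
  simp only [h1]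
  rw [Finset.sum_Icc_sub_pred (fun i : ℤ => (K.persistentBetti d i ⊤ : ℤ)) (by omega)]
  have h2 := K.persistentBetti_add_finrank d (s := (-N - 1 : ℤ)) (t := ⊤) le_top
  have h3 := K.persistentBetti_add_finrank d (s := (N : ℤ)) (t := ⊤) le_top
  have h4 := K.persistentBetti_add_finrank d (s := ⊤) (t := ⊤) le_top
  rw [hN.cycles_of_lt_neg d (by omega), finrank_bot] at h2
  rw [hN.cycles_of_le d le_rfl] at h3
  omega

/-- For a fixed death `j`, the sum over births telescopes and stops at `j - 1`, because only
intervals of positive length count. This holds without reducedness: the summand counts the cycles of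
level `j - 1` that become boundaries exactly at `j`. -/
theorem BoundedBy.numFinite_eq :
    (numFinite B : ℤ) = ∑ d ∈ Finset.range (N + 1), ∑ j ∈ Finset.Icc (-N : ℤ) N,
      ((Module.finrank F (K.cycles d (j - 1 : ℤ) ⊓ K.boundaries d j : Submodule F (ι → F)) : ℤ) -
        Module.finrank F (K.boundaries d (j - 1 : ℤ))) := by
  classical
  let S : Finset (ℕ × ℤ × WithTop ℤ) := Finset.range (N + 1) ×ˢ Finset.Icc (-N : ℤ) N ×ˢ
    ((Finset.Icc (-N : ℤ) N).image (fun j : ℤ => (j : WithTop ℤ)))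
  have hS : ∀ x ∈ B.filter (fun I => I.2.2 ≠ ⊤), x ∈ S := by
    rintro ⟨d, i, j⟩ hx
    rw [Multiset.mem_filter] at hx
    obtain ⟨hx, hj⟩ := hx
    lift j to ℤ using hj
    have h := hN.multiplicity_coe_ne_zero (d := d) (i := i) (j := j) (by
      rw [← hB]
      exact_mod_cast (Multiset.count_pos.2 hx).ne')
    simp only [S, Finset.mem_product, Finset.mem_range, Finset.mem_Icc, Finset.mem_image]
    exact ⟨by omega, by omega, j, by omega, rfl⟩
  rw [numFinite, Multiset.countP_eq_card_filter, ← Multiset.sum_count_eq_card hS,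
    Finset.sum_product, Nat.cast_sum]
  refine Finset.sum_congr rfl fun d _ => ?_
  rw [Finset.sum_product_right, Finset.sum_image (fun _ _ _ _ h => WithTop.coe_injective h),
    Nat.cast_sum]
  refine Finset.sum_congr rfl fun j hj => ?_
  rw [Finset.mem_Icc] at hj
  let f : ℤ → ℤ := fun i =>
    (Module.finrank F (K.cycles d i ⊓ K.boundaries d j : Submodule F (ι → F)) : ℤ) -
      Module.finrank F (K.cycles d i ⊓ K.boundaries d (j - 1 : ℤ) : Submodule F (ι → F))
  have h1 : ∀ i : ℤ, ((B.filter (fun I => I.2.2 ≠ ⊤)).count (d, i, (j : WithTop ℤ)) : ℤ) =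
      if i < j then f i - f (i - 1) else 0 := by
    intro i
    rw [Multiset.count_filter_of_pos (p := fun I : ℕ × ℤ × WithTop ℤ => I.2.2 ≠ ⊤)
      WithTop.coe_ne_top, hB]
    split_ifs with hij
    · exact K.multiplicity_coe_of_lt d hij
    · exact K.multiplicity_coe_of_le d (not_lt.1 hij)
  have h2 : (Finset.Icc (-N : ℤ) N).filter (fun i => i < j) = Finset.Ico (-N : ℤ) j := by
    ext i
    simp only [Finset.mem_filter, Finset.mem_Icc, Finset.mem_Ico]
    omega
  rw [Nat.cast_sum, Finset.sum_congr rfl fun i _ => h1 i, ← Finset.sum_filter, h2,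
    Finset.sum_Ico_sub_pred f hj.1]
  have h3 : f (-N - 1) = 0 := by
    simp only [f]
    rw [hN.cycles_of_lt_neg d (show (-N - 1 : ℤ) < -N by omega), bot_inf_eq, bot_inf_eq, sub_self]
  rw [h3, sub_zero]
  simp only [f]
  rw [inf_eq_right.2 (K.boundaries_le_cycles d (j - 1 : ℤ))]

/-- A complex without incidences between cells of the same level has two cells for every finite
and one for every infinite interval. -/
theorem card_cells_of_reduced (hK : ∀ A b, K.inc A b ≠ 0 → K.lvl b ≠ K.lvl A) :
    K.cells.card = 2 * numFinite B + numInfinite B := by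
  -- Every face lies strictly below its coface, so a boundary taken in `K_j` is supported in
  -- `K_{j-1}`. The intersections in `numFinite_eq` become all of `B_j`, and the sum over deaths
  -- telescopes as well.
  have hle : ∀ (d : ℕ) (j : ℤ), K.boundaries d j ≤ K.cycles d (j - 1 : ℤ) := by
    rintro d j _ ⟨c, hc, rfl⟩
    refine ⟨fun y hy => ?_, K.boundary_boundary c⟩
    obtain ⟨h1, h2, -⟩ := K.boundary_mem_chains hc y hy
    obtain ⟨x, hx, hxy⟩ := vecMul_ne_zero hy
    have h3 := WithTop.coe_le_coe.1 (hc x hx).2.2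
    have h4 := K.lvl_of_inc _ _ hxy
    have h5 := hK _ _ hxy
    exact ⟨h1, h2, WithTop.coe_le_coe.2 (by omega)⟩
  have hfin : (numFinite B : ℤ) = ∑ d ∈ Finset.range (N + 1),
      (Module.finrank F (K.boundaries d ⊤) : ℤ) := by
    rw [hN.numFinite_eq hB]
    refine Finset.sum_congr rfl fun d _ => ?_
    have h1 : ∀ j : ℤ, Module.finrank F
        (K.cycles d (j - 1 : ℤ) ⊓ K.boundaries d j : Submodule F (ι → F)) =
        Module.finrank F (K.boundaries d j) := fun j => by rw [inf_eq_right.2 (hle d j)]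
    simp only [h1]
    rw [Finset.sum_Icc_sub_pred (fun j : ℤ => (Module.finrank F (K.boundaries d j) : ℤ)) (by omega),
      hN.boundaries_of_le d le_rfl, hN.boundaries_of_lt_neg d (by omega), finrank_bot]
    simp
  have hinf : (numInfinite B : ℤ) = ∑ d ∈ Finset.range (N + 1),
      ((Module.finrank F (K.cycles d ⊤) : ℤ) - Module.finrank F (K.boundaries d ⊤)) := by
    rw [hN.numInfinite_eq hB]
    refine Finset.sum_congr rfl fun d _ => ?_
    have h := K.persistentBetti_add_finrank d (s := ⊤) (t := ⊤) le_rfl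
    rw [inf_eq_right.2 (K.boundaries_le_cycles d ⊤)] at h
    omega
  have hc := hN.card_cells
  zify
  rw [hc, hfin, hinf]
  push_cast
  rw [Finset.sum_add_distrib, Finset.sum_sub_distrib]
  ring

end Count

end FilteredComplex

/-! ### Matchings with at most one pair -/

namespace FilteredMatching

section Trivial

variable {F : Type*} [Field F] {ι : Type*} [Fintype ι]

/-- The matching with the single pair `(b, A)`. -/
def single (K : FilteredComplex F ι) (b A : ι) (h : K.inc A b ≠ 0) (hl : K.lvl b = K.lvl A) :
    FilteredMatching K where
  pair x y := x = b ∧ y = A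
  inc_ne_zero := by rintro _ _ ⟨rfl, rfl⟩; exact h
  up_unique := by rintro _ _ _ ⟨-, rfl⟩ ⟨-, rfl⟩; rfl
  down_unique := by rintro _ _ _ ⟨rfl, -⟩ ⟨rfl, -⟩; rfl
  not_both := by
    rintro _ _ _ ⟨rfl, rfl⟩ ⟨h1, -⟩
    have := K.dim_of_inc _ _ h
    rw [h1] at this
    omega
  acyclic := by
    classical
    have hd := K.dim_of_inc _ _ h
    -- A height that falls along every edge of the Morse graph. With `d = dim b`, the cell `A` sinks
    -- from `4d + 4` to `4d + 1`, still above its other faces at `4d`; `b` rises to `4d + 2`, above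
    -- `A` but below its other cofaces at `4d + 4`.
    let r : ι → ℕ := fun x =>
      if x = b then 4 * K.dim b + 2 else if x = A then 4 * K.dim b + 1 else 4 * K.dim x
    have edge : ∀ x y, MorseEdge K.inc (fun x y => x = b ∧ y = A) x y → r y < r x := by
      have hAb : A ≠ b := by
        rintro rfl
        omega
      rintro x y (⟨h1, h2⟩ | ⟨rfl, rfl⟩)
      · have h3 := K.dim_of_inc _ _ h1
        simp only [r]
        split_ifs <;> subst_vars <;> first | omega | exact absurd ⟨rfl, rfl⟩ h2
      · simp [r, hAb]
    have key : ∀ x y, Relation.TransGen (MorseEdge K.inc fun x y => x = b ∧ y = A) x y →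
        r y < r x := by
      intro x y hxy
      induction hxy with
      | single e => exact edge _ _ e
      | tail _ e ih => exact (edge _ _ e).trans ih
    exact fun x hx => lt_irrefl _ (key x x hx)
  compatible := by rintro _ _ ⟨rfl, rfl⟩; exact hl

/-- The empty matching. -/
def empty (K : FilteredComplex F ι) : FilteredMatching K where
  pair _ _ := False
  inc_ne_zero := fun _ _ h => h.elim
  up_unique := fun _ _ _ h => h.elim
  down_unique := fun _ _ _ h => h.elim
  not_both := fun _ _ _ h => h.elim
  acyclic := by
    have key : ∀ x y, Relation.TransGen (MorseEdge K.inc fun _ _ => False) x y →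
        K.dim y < K.dim x := by
      have edge : ∀ x y, MorseEdge K.inc (fun _ _ => False) x y → K.dim y < K.dim x := by
        rintro x y (⟨h1, -⟩ | h)
        · have := K.dim_of_inc _ _ h1
          omega
        · exact h.elim
      intro x y hxy
      induction hxy with
      | single e => exact edge _ _ e
      | tail _ e ih => exact (edge _ _ e).trans ih
    exact fun x hx => lt_irrefl _ (key x x hx)
  compatible := fun _ _ h => h.elim

end Trivial

end FilteredMatching

/-! ### Fixed points, iteration and minimality -/

namespace FilteredComplex

variable {F : Type*} [Field F] {ι : Type*} [Fintype ι] [DecidableEq ι]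

/-- Without reversed edges only the `k = 0` term of the path sum survives, and it is the original
boundary. -/
theorem morseComplex_eq_self (K : FilteredComplex F ι) (m : FilteredMatching K)
    (h : ¬ m.Nontrivial) : K.morseComplex m = K := by
  classical
  have hp : ∀ b A, ¬ m.pair b A := fun b A hb => h ⟨b, A, hb⟩
  have hc : m.critical = K.cells :=
    Finset.filter_true_of_mem fun x _ => by simp [FilteredMatching.Matched, hp]
  have hup : m.up = 0 := by
    ext x y
    simp [FilteredMatching.up, hp]
  have hdown : m.down = K.inc := by
    ext x y
    simp [FilteredMatching.down, hp]
  have hs : m.pathSum = K.inc := by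
    rw [FilteredMatching.pathSum, Finset.sum_range_succ', Finset.sum_eq_zero]
    · simp [hdown]
    · intro k _
      simp [hup]
  refine FilteredComplex.ext hc rfl rfl ?_
  ext A b
  change m.morseInc A b = _
  rw [FilteredMatching.morseInc, Matrix.of_apply, hs, hc]
  split_ifs with hAb
  · rfl
  · by_contra h0
    exact hAb (K.mem_of_inc A b (Ne.symm h0))

theorem card_cells_morseComplex_lt (K : FilteredComplex F ι) (m : FilteredMatching K)
    (h : m.Nontrivial) : (K.morseComplex m).cells.card < K.cells.card := by
  classical
  obtain ⟨b, A, hb⟩ := h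
  refine Finset.card_lt_card (Finset.filter_ssubset.2 ⟨b, ?_, ?_⟩)
  · exact (K.mem_of_inc _ _ (m.inc_ne_zero _ _ hb)).2
  · exact not_not.2 (Or.inl ⟨A, hb⟩)

variable (σ : (K : FilteredComplex F ι) → FilteredMatching K)

theorem isFixedPt_morseStep_iff (K : FilteredComplex F ι) :
    Function.IsFixedPt (morseStep σ) K ↔ ¬ (σ K).Nontrivial := by
  refine ⟨fun h hn => ?_, fun h => K.morseComplex_eq_self (σ K) h⟩
  have h1 := K.card_cells_morseComplex_lt (σ K) hn
  rw [show K.morseComplex (σ K) = K from h] at h1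
  exact lt_irrefl _ h1

/-- Every step that is not a fixed point removes a cell, so the sequence must stop. -/
theorem isFixedPt_iteratedMorse (K : FilteredComplex F ι) :
    Function.IsFixedPt (morseStep σ) (iteratedMorse σ K) := by
  -- On the empty set `sInf` would take the default value 0, so nonemptiness is the whole content.
  suffices h : {n : ℕ | Function.IsFixedPt (morseStep σ) ((morseStep σ)^[n] K)}.Nonempty from
    Nat.sInf_mem h
  by_contra hne
  have hn : ∀ n, ¬ Function.IsFixedPt (morseStep σ) ((morseStep σ)^[n] K) :=
    fun n h => hne ⟨n, h⟩
  have key : ∀ n, ((morseStep σ)^[n] K).cells.card + n ≤ K.cells.card := by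
    intro n
    induction n with
    | zero => simp
    | succ n ih =>
      have h1 := hn n
      rw [isFixedPt_morseStep_iff, not_not] at h1
      have h2 := card_cells_morseComplex_lt _ _ h1
      rw [Function.iterate_succ_apply']
      change (((morseStep σ)^[n] K).morseComplex _).cells.card + (n + 1) ≤ _
      omega
  have := key (K.cells.card + 1)
  omega

theorem persistentBetti_iterate (K : FilteredComplex F ι) (n d : ℕ) (s t : WithTop ℤ) :
    ((morseStep σ)^[n] K).persistentBetti d s t = K.persistentBetti d s t := by
  induction n with
  | zero => rfl
  | succ n ih =>
    rw [Function.iterate_succ_apply', ← ih]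
    exact persistentBetti_morseComplex _ _ d s t

theorem card_cells_iterate_le (K : FilteredComplex F ι) (n : ℕ) :
    ((morseStep σ)^[n] K).cells.card ≤ K.cells.card := by
  classical
  induction n with
  | zero => rfl
  | succ n ih =>
    rw [Function.iterate_succ_apply']
    exact (Finset.card_le_card (Finset.filter_subset _ _)).trans ih

theorem isBarcode_iteratedMorse (K : FilteredComplex F ι) {B : Multiset (ℕ × ℤ × WithTop ℤ)}
    (hB : K.IsBarcode B) : (iteratedMorse σ K).IsBarcode B := by
  intro d i j
  rw [hB, K.multiplicity_congr (L := iteratedMorse σ K) (K.persistentBetti_iterate σ _)]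

variable {σ}

theorem card_cells_iteratedMorse (hσ : Vital σ) (K : FilteredComplex F ι)
    {B : Multiset (ℕ × ℤ × WithTop ℤ)} (hB : K.IsBarcode B) :
    (iteratedMorse σ K).cells.card = 2 * numFinite B + numInfinite B := by
  obtain ⟨N, hN⟩ := (iteratedMorse σ K).exists_boundedBy
  refine card_cells_of_reduced hN (K.isBarcode_iteratedMorse σ hB) fun A b h hl => ?_
  have hf := (isFixedPt_morseStep_iff σ _).1 (isFixedPt_iteratedMorse σ K)
  -- An incidence within a level would be a nontrivial matching, which vitality forbids at a fixed
  -- point.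
  exact hf (hσ _ ⟨FilteredMatching.single _ b A h hl, b, A, rfl, rfl⟩)

omit [DecidableEq ι] in
-- Lets the exact count be applied to an arbitrary complex, which comes with no strategy of its own.
theorem exists_vital : ∃ σ : (K : FilteredComplex F ι) → FilteredMatching K, Vital σ := by
  classical
  refine ⟨fun K => if h : ∃ m : FilteredMatching K, m.Nontrivial then h.choose else .empty K,
    fun K h => ?_⟩
  simp only [dif_pos h]
  exact h.choose_spec

omit [DecidableEq ι] in
-- The lower bound needs no separate argument: the complex has at least as many cells as its own
-- reduction, whose size the barcode determines.
theorem two_mul_numFinite_add_numInfinite_le (K : FilteredComplex F ι)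
    {B : Multiset (ℕ × ℤ × WithTop ℤ)} (hB : K.IsBarcode B) :
    2 * numFinite B + numInfinite B ≤ K.cells.card := by
  classical
  obtain ⟨σ, hσ⟩ := exists_vital (F := F) (ι := ι)
  rw [← card_cells_iteratedMorse hσ K hB]
  exact K.card_cells_iterate_le σ _

end FilteredComplex

theorem mainTheorem2 {F : Type*} [Field F] {ι : Type*} [Fintype ι] [DecidableEq ι]
    (σ : (K : FilteredComplex F ι) → FilteredMatching K) (hσ : FilteredComplex.Vital σ)
    (K : FilteredComplex F ι) :
    Function.IsFixedPt (FilteredComplex.morseStep σ) (FilteredComplex.iteratedMorse σ K) ∧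
    (∃ B, K.IsBarcode B) ∧
    ∀ B, K.IsBarcode B →
      (FilteredComplex.iteratedMorse σ K).cells.card = 2 * numFinite B + numInfinite B ∧
      (FilteredComplex.iteratedMorse σ K).IsBarcode B ∧
      ∀ (ι' : Type*) [Fintype ι'] (L : FilteredComplex F ι'), L.IsBarcode B →
        (FilteredComplex.iteratedMorse σ K).cells.card ≤ L.cells.card := by
  refine ⟨FilteredComplex.isFixedPt_iteratedMorse σ K, K.exists_isBarcode, fun B hB => ?_⟩
  have hc := FilteredComplex.card_cells_iteratedMorse hσ K hB
  refine ⟨hc, K.isBarcode_iteratedMorse σ hB, fun ι' _ L hL => ?_⟩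
  rw [hc]
  exact L.two_mul_numFinite_add_numInfinite_le hL
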